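/- Consider a single-server queue with vacations, glue periods and retrials. Customers arrive according to a Poisson process of rate $\lambda>0$. Time is divided into cycles, each consisting of a glue period of deterministic length $G>0$, then a visit period, then a vacation. A customer who arrives or retries during a glue period sticks, that is, joins the queue; a customer who arrives or retries at any other time goes into orbit and retries after an exponentially distributed time of rate $\nu>0$. In the visit period the server serves exactly the customers that are glued in the queue at the end of the preceding glue period (gated service), after which they leave. Service times are nonnegative with generic variable $B$ and transform $\tilde B(s)=\mathbb E[e^{-sB}]$; vacation lengths are nonnegative with generic variable $S$ and transform $\tilde S(s)=\mathbb E[e^{-sS}]$; assume $\mathbb E[B]<\infty$ and $\mathbb E[S]<\infty$. All interarrival times, retrial intervals, service times, vacation lengths and the initial number of customers in orbit are mutually independent, and the first glue period starts at time $0$. Let $X_n$ be the number of customers in the system (all of them in orbit) at the start of the $n$-th glue period. For complex $|z|\le 1$ put $\beta(z)=\tilde B(\lambda(1-z))$, $\sigma(z)=\tilde S(\lambda(1-z))$, \[ f(z)=(1-e^{-\nu G})\beta(z)+e^{-\nu G}z,\qquad K(z)=\sigma(z)\,e^{-\lambda(1-\beta(z))G}, \] and let $f^{(0)}(z)=z$,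 $f^{(j)}(z)=f(f^{(j-1)}(z))$ for $j\ge1$. If $\rho:=\lambda\,\mathbb E[B]<1$, then $X_n$ converges in distribution, as $n\to\infty$, to a random variable $X$ with values in $\{0,1,2,\dots\}$, and for every complex $z$ with $|z|\le1$ the infinite product below converges and \[ \mathbb E[z^X]=\prod_{j=0}^{\infty}K\bigl(f^{(j)}(z)\bigr). \] -/

import Mathlib

open MeasureTheory ProbabilityTheory Filter

namespace GlueQueue

/-- Labels of the customers of the queue: those who are already in orbit at time `0`, and those who
arrive at the points of the Poisson process (in order of arrival). -/
inductive Customer : Type where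
  | initial (i : ℕ) : Customer
  | arriving (j : ℕ) : Customer

/-- The random data that drive the queue. -/
structure Input (Ω : Type*) where
  /-- the number of customers in orbit at time `0`, when the first glue period starts -/
  initial : Ω → ℕ
  /-- the successive interarrival times -/
  interarrival : ℕ → Ω → ℝ
  /-- `retrial c m` is the `m`-th retrial interval of customer `c` -/
  retrial : Customer → ℕ → Ω → ℝ
  /-- the service time of each customer -/
  service : Customer → Ω → ℝ
  /-- the length of the vacation that follows the `n`-th visit period -/
  vacation : ℕ → Ω → ℝ

/-- Labels of all the random variables that drive the queue. -/
inductive Source : Type where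
  | initial : Source
  | interarrival (j : ℕ) : Source
  | retrial (c : Customer) (m : ℕ) : Source
  | service (c : Customer) : Source
  | vacation (n : ℕ) : Source

namespace Input

variable {Ω : Type*} (I : Input Ω)

/-- All the driving random variables, as one family of real random variables. -/
def driver : Source → Ω → ℝ
  | .initial => fun ω => (I.initial ω : ℝ)
  | .interarrival j => I.interarrival j
  | .retrial c m => I.retrial c m
  | .service c => I.service c
  | .vacation n => I.vacation n

/-- The probabilistic assumptions: the arrivals form a Poisson process of rate `lam` (i.i.d.
exponential interarrival times), the retrial intervals are exponential of rate `ν`, the service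
times have law `B`, the vacations have law `S`, and all these variables and the initial number of
customers (whose law is arbitrary) are mutually independent. -/
structure IsModel [MeasurableSpace Ω] (lam ν : ℝ) (B S : Measure ℝ) (P : Measure Ω) : Prop where
  aemeasurable_initial : AEMeasurable I.initial P
  law_interarrival : ∀ j, HasLaw (I.interarrival j) (expMeasure lam) P
  law_retrial : ∀ c m, HasLaw (I.retrial c m) (expMeasure ν) P
  law_service : ∀ c, HasLaw (I.service c) B P
  law_vacation : ∀ n, HasLaw (I.vacation n) S P
  indep : iIndepFun I.driver P

/-- The time from which customer `c` is in the system: `0` for the initial customers, and the `j`-th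
point of the Poisson process for the `j`-th arriving customer. -/
def entry (ω : Ω) : Customer → ℝ
  | .initial _ => 0
  | .arriving j => ∑ i ∈ Finset.range (j + 1), I.interarrival i ω

/-- Whether the label `c` belongs to a customer: only `I.initial ω` initial customers exist. -/
def Exists (ω : Ω) : Customer → Prop
  | .initial i => i < I.initial ω
  | .arriving _ => True

/-- `I.Attempt ω c t`: customer `c` tries at time `t` to join the queue. An arriving customer tries
at its arrival and again after each of its retrial intervals; a customer who is in orbit at time `0`
tries after each of its retrial intervals. -/
def Attempt (ω : Ω) (c : Customer) (t : ℝ) : Prop :=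
  match c with
  | .initial i => ∃ m : ℕ,
      t = ∑ k ∈ Finset.range (m + 1), I.retrial (.initial i) k ω
  | .arriving j => ∃ m : ℕ,
      t = I.entry ω (.arriving j) + ∑ k ∈ Finset.range m, I.retrial (.arriving j) k ω

/-- The customers who are glued during the glue period `[g, g + G)`, where `D` is the set of those
who have left the system before: they try to join the queue during that period. -/
def glued (G : ℝ) (ω : Ω) (g : ℝ) (D : Set Customer) : Set Customer :=
  {c | I.Exists ω c ∧ c ∉ D ∧ ∃ t ∈ Set.Ico g (g + G), I.Attempt ω c t}

/-- The pair of the starting time of the `n`-th glue period and the set of customers whose service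
has been completed by then. A glue period has length `G`; it is followed by a visit period, in which
exactly the customers glued in it are served, and then by a vacation. -/
noncomputable def cycle (G : ℝ) (ω : Ω) : ℕ → ℝ × Set Customer
  | 0 => (0, ∅)
  | n + 1 =>
    let g := (cycle G ω n).1
    let D := (cycle G ω n).2
    let Q := I.glued G ω g D
    (g + G + (∑' c, Q.indicator (fun c => I.service c ω) c) + I.vacation n ω, D ∪ Q)

/-- The number `X n` of customers in the system at the start of the `n`-th glue period. -/
noncomputable def X (G : ℝ) (n : ℕ) (ω : Ω) : ℕ :=
  Set.ncard {c | I.Exists ω c ∧ I.entry ω c ≤ (I.cycle G ω n).1 ∧ c ∉ (I.cycle G ω n).2}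

end Input

/-- The Laplace-Stieltjes transform of a law on `[0, ∞)`. -/
noncomputable def lst (μ : Measure ℝ) (s : ℂ) : ℂ := ∫ x : ℝ, Complex.exp (-(s * x)) ∂μ

/-- `β(z)` for the service time law, `σ(z)` for the vacation law: the generating function of the
number of Poisson arrivals of rate `lam` during a time with law `μ`. -/
noncomputable def arrivalsPGF (lam : ℝ) (μ : Measure ℝ) (z : ℂ) : ℂ := lst μ (lam * (1 - z))

/-- `f(z) = (1 - e^{-νG}) β(z) + e^{-νG} z`. -/
noncomputable def f (lam ν G : ℝ) (B : Measure ℝ) (z : ℂ) : ℂ :=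
  (1 - Complex.exp (-(ν * G))) * arrivalsPGF lam B z + Complex.exp (-(ν * G)) * z

/-- `K(z) = σ(z) e^{-λ(1 - β(z))G}`. -/
noncomputable def K (lam G : ℝ) (B S : Measure ℝ) (z : ℂ) : ℂ :=
  arrivalsPGF lam S z * Complex.exp (-(lam * (1 - arrivalsPGF lam B z) * G))

end GlueQueue

/-! The heart of the proof is the recursion `E[z^X_{n+1}] = K(z) E[f(z)^X_n]`
(`integral_pow_X_succ`). By memorylessness, each customer in orbit when a glue period starts is
glued in it with probability `1 - e^{-νG}`, independently of the past and of the others. A glued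
customer is replaced by the Poisson arrivals during its service, with generating function `β(z)`; an
unglued one keeps its weight `z`. This gives `f(z)` per customer. The arrivals during the glue
period stick at once and give `e^{-λ(1-β(z))G}`; those during the vacation give `σ(z)`.

The obstacle is that the glue periods start at random times that depend on who was served before.
The space is therefore cut into countably many events `historyEvent`, on each of which the finite
sets glued so far are prescribed. There the starting times are the explicit functions `sched` of the
service times and vacations. Once these durations are frozen, by resampling all other coordinates
(`integral_mix`), the schedule is deterministic. Three facts about a fixed schedule then suffice:
later arrivals are Poisson and independent of the past (`integral_history_orbit_mul_arrivals`),
retrials act customer by customer (`integral_history_orbit_glued`), and the next service times and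
vacation are independent of the history (`integral_durations_mul_history`).

Iteration gives `E[z^X_n] = ∏_{j<n} K(f^(j)(z)) · E[(f^(n)(z))^X_0]`. On the closed disc `|1 - f(z)|
≤ c|1 - z|` with `c = (1 - e^{-νG})ρ + e^{-νG} < 1`, and `|1 - K(z)| ≤ M|1 - z|`. So the product
converges, the last factor tends to `1`, and the limit is continuous at `1`; the continuity theorem
`exists_tendsto_of_tendsto_pgf` concludes. -/

namespace GlueQueue

/-! ### Resampling a block of coordinates of a product measure. -/

section Resampling

variable {ι : Type*} {μ : ι → Measure ℝ} [∀ i, IsProbabilityMeasure (μ i)]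

open Classical in
/-- The family that agrees with `y` on `s` and with `x` off `s`. -/
noncomputable def mix (s : Set ι) (x y : ι → ℝ) : ι → ℝ := fun i => if i ∈ s then y i else x i

lemma mix_of_mem {s : Set ι} {x y : ι → ℝ} {i : ι} (h : i ∈ s) : mix s x y i = y i := if_pos h

lemma mix_of_notMem {s : Set ι} {x y : ι → ℝ} {i : ι} (h : i ∉ s) : mix s x y i = x i := if_neg h

@[fun_prop]
lemma measurable_mix (s : Set ι) : Measurable fun p : (ι → ℝ) × (ι → ℝ) => mix s p.1 p.2 := by
  refine measurable_pi_lambda _ fun i => ?_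
  by_cases h : i ∈ s
  · simp only [mix, h, if_true]; fun_prop
  · simp only [mix, h, if_false]; fun_prop

@[fun_prop]
lemma measurable_mix_right (s : Set ι) (x : ι → ℝ) : Measurable (mix s x) :=
  (measurable_mix s).comp measurable_prodMk_left

variable (μ) in
-- It suffices to test boxes: the preimage of a box is the product of a box in the coordinates off
-- `s` and a box in those of `s`.
lemma map_mix (s : Set ι) :
    ((Measure.infinitePi μ).prod (Measure.infinitePi μ)).map (fun p => mix s p.1 p.2)
      = Measure.infinitePi μ := by
  classical
  refine Measure.eq_infinitePi _ fun F t ht => ?_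
  rw [Measure.map_apply (measurable_mix s)
    (MeasurableSet.pi F.countable_toSet fun i _ => ht i)]
  have : (fun p : (ι → ℝ) × (ι → ℝ) => mix s p.1 p.2) ⁻¹' (Set.pi F t)
      = (Set.pi (F.filter (· ∉ s) : Finset ι) t) ×ˢ (Set.pi (F.filter (· ∈ s) : Finset ι) t) := by
    ext p
    simp only [Set.mem_preimage, Set.mem_pi, Set.mem_prod, Finset.mem_coe, Finset.mem_filter]
    constructor
    · exact fun h => ⟨fun i hi => by simpa [mix, hi.2] using h i hi.1,
        fun i hi => by simpa [mix, hi.2] using h i hi.1⟩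
    · intro h i hi
      by_cases his : i ∈ s
      · simpa [mix, his] using h.2 i ⟨hi, his⟩
      · simpa [mix, his] using h.1 i ⟨hi, his⟩
  rw [this, Measure.prod_prod, Measure.infinitePi_pi _ fun i _ => ht i,
    Measure.infinitePi_pi _ fun i _ => ht i, mul_comm,
    Finset.prod_filter_mul_prod_filter_not]

/-- This replaces conditioning on the coordinates off `s`: the outer variable freezes them, the
inner one resamples those in `s`. -/
lemma integral_mix (s : Set ι) {F : (ι → ℝ) → ℂ} (hF : Integrable F (Measure.infinitePi μ)) :
    ∫ x, F x ∂Measure.infinitePi μ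
      = ∫ x, ∫ y, F (mix s x y) ∂Measure.infinitePi μ ∂Measure.infinitePi μ := by
  have h := map_mix μ s
  have hF' := hF
  rw [← h] at hF'
  conv_lhs => rw [← h]
  rw [integral_map (by fun_prop) hF'.aestronglyMeasurable]
  exact integral_prod _ (hF'.comp_measurable (measurable_mix s))

lemma ae_mix (s : Set ι) {p : (ι → ℝ) → Prop} (h : ∀ᵐ x ∂Measure.infinitePi μ, p x) :
    ∀ᵐ x ∂Measure.infinitePi μ, ∀ᵐ y ∂Measure.infinitePi μ, p (mix s x y) := by
  have h' := h
  rw [← map_mix μ s] at h'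
  exact Measure.ae_ae_of_ae_prod (ae_of_ae_map (by fun_prop) h')

lemma ae_of_ae_mix (s : Set ι) {p : (ι → ℝ) → Prop} (hp : MeasurableSet {x | p x})
    (h : ∀ᵐ x ∂Measure.infinitePi μ, ∀ᵐ y ∂Measure.infinitePi μ, p (mix s x y)) :
    ∀ᵐ x ∂Measure.infinitePi μ, p x := by
  rw [← map_mix μ s, ae_map_iff (by fun_prop) hp, Measure.ae_prod_iff_ae_ae]
  · exact h
  · exact measurable_mix s hp

lemma integral_congr_mix (s : Set ι) {F F' : (ι → ℝ) → ℂ}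
    (hF : Integrable F (Measure.infinitePi μ)) (hF' : Integrable F' (Measure.infinitePi μ))
    (h : ∀ᵐ x ∂Measure.infinitePi μ, ∫ y, F (mix s x y) ∂Measure.infinitePi μ
      = ∫ y, F' (mix s x y) ∂Measure.infinitePi μ) :
    ∫ x, F x ∂Measure.infinitePi μ = ∫ x, F' x ∂Measure.infinitePi μ := by
  rw [integral_mix s hF, integral_mix s hF']
  exact integral_congr_ae h

/-- After `s` is resampled, `F` sees only the new copy and `H` only the old one. -/
lemma integral_mul_of_dependsOn {s : Set ι} {F H : (ι → ℝ) → ℂ} (hF : DependsOn F s)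
    (hH : DependsOn H sᶜ) (hFH : Integrable (fun x => F x * H x) (Measure.infinitePi μ)) :
    ∫ x, F x * H x ∂Measure.infinitePi μ
      = (∫ x, F x ∂Measure.infinitePi μ) * ∫ x, H x ∂Measure.infinitePi μ := by
  rw [integral_mix s hFH, ← integral_const_mul]
  refine integral_congr_ae (.of_forall fun x => ?_)
  have h1 : ∀ y, F (mix s x y) = F y := fun y => hF fun i hi => mix_of_mem hi
  have h2 : ∀ y, H (mix s x y) = H x := fun y => hH fun i hi => mix_of_notMem hi
  simp only [h1, h2, integral_mul_const]

lemma integral_prod_of_dependsOn {κ : Type*} (C : Finset κ) {s : κ → Set ι}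
    (hs : Pairwise (Function.onFun Disjoint s)) {F : κ → (ι → ℝ) → ℂ}
    (hF : ∀ c, DependsOn (F c) (s c)) (hm : ∀ c, Measurable (F c))
    (hb : ∀ c x, ‖F c x‖ ≤ 1) :
    ∫ x, ∏ c ∈ C, F c x ∂Measure.infinitePi μ = ∏ c ∈ C, ∫ x, F c x ∂Measure.infinitePi μ := by
  classical
  induction C using Finset.induction_on with
  | empty => simp
  | insert c C hc ih =>
    simp only [Finset.prod_insert hc]
    rw [integral_mul_of_dependsOn (hF c), ih]
    · intro x y h
      refine Finset.prod_congr rfl fun d hd => hF d fun i hi => h i ?_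
      have hcd : d ≠ c := fun e => hc (e ▸ hd)
      exact fun hi' => (Set.disjoint_left.1 (hs hcd)) hi hi'
    · refine Integrable.of_bound (C := 1) (by fun_prop) (.of_forall fun x => ?_)
      rw [norm_mul, norm_prod]
      exact mul_le_one₀ (hb c x) (by positivity) (Finset.prod_le_one (by simp) fun d _ => hb d x)

lemma ae_infinitePi_eval (i : ι) {p : ℝ → Prop} (h : ∀ᵐ u ∂μ i, p u) :
    ∀ᵐ x ∂Measure.infinitePi μ, p (x i) :=
  (measurePreserving_eval_infinitePi μ i).quasiMeasurePreserving.ae h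

lemma integral_infinitePi_comp_injective {κ : Type*} {e : κ → ι} (he : Function.Injective e)
    {F : (κ → ℝ) → ℂ} (hF : Measurable F) :
    ∫ x, F (fun k => x (e k)) ∂Measure.infinitePi μ
      = ∫ u, F u ∂Measure.infinitePi (fun k => μ (e k)) := by
  rw [← Measure.map_infinitePi_infinitePi_of_inj he,
    integral_map (Measurable.aemeasurable (by fun_prop)) hF.aestronglyMeasurable]

lemma ae_infinitePi_comp_injective {κ : Type*} {e : κ → ι} (he : Function.Injective e)
    {p : (κ → ℝ) → Prop} (h : ∀ᵐ u ∂Measure.infinitePi (fun k => μ (e k)), p u) :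
    ∀ᵐ x ∂Measure.infinitePi μ, p (fun k => x (e k)) := by
  rw [← Measure.map_infinitePi_infinitePi_of_inj he] at h
  exact ae_of_ae_map (Measurable.aemeasurable (by fun_prop)) h

lemma integral_infinitePi_eval (i : ι) (F : ℝ → ℂ) (hF : Measurable F) :
    ∫ x, F (x i) ∂Measure.infinitePi μ = ∫ u, F u ∂μ i := by
  rw [← Measure.infinitePi_map_eval μ i, integral_map (Measurable.aemeasurable (by fun_prop)) hF.aestronglyMeasurable]

end Resampling

/-- Allows a random finite set of customers, or a random number of points, to be treated as
constant: one piece for each of its countably many values. -/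
lemma integral_eq_of_countable_partition {Ω κ : Type*} [MeasurableSpace Ω] [Countable κ]
    {P : Measure Ω} {A : κ → Set Ω} (hA : ∀ i, MeasurableSet (A i))
    (hd : Pairwise (Function.onFun Disjoint A)) (hcov : ∀ᵐ x ∂P, ∃ i, x ∈ A i) {F F' : Ω → ℂ}
    (hF : Integrable F P) (hF' : Integrable F' P)
    (h : ∀ i, ∫ x in A i, F x ∂P = ∫ x in A i, F' x ∂P) : ∫ x, F x ∂P = ∫ x, F' x ∂P := by
  have key : ∀ H : Ω → ℂ, Integrable H P → HasSum (fun i => ∫ x in A i, H x ∂P) (∫ x, H x ∂P) := by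
    intro H hH
    have := hasSum_integral_iUnion hA hd hH.integrableOn
    rwa [setIntegral_eq_integral_of_ae_compl_eq_zero] at this
    filter_upwards [hcov] with x hx hx'
    exact absurd (Set.mem_iUnion.2 hx) hx'
  have h1 := key F hF
  simp only [h] at h1
  exact h1.unique (key F' hF')


lemma measurable_ncard {α Ω : Type*} [Countable α] [MeasurableSpace Ω] {A : Ω → Set α}
    (h : ∀ c, MeasurableSet {ω | c ∈ A ω}) : Measurable fun ω => (A ω).ncard := by
  classical
  have hF : ∀ F : Finset α, MeasurableSet {ω | A ω = F} := by
    intro F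
    have : {ω | A ω = F} = ⋂ c, {ω | c ∈ A ω ↔ c ∈ F} := by
      ext ω; simp [Set.ext_iff]
    rw [this]
    refine MeasurableSet.iInter fun c => ?_
    by_cases hc : c ∈ F
    · simp only [hc, iff_true]; exact h c
    · simp only [hc, iff_false]; exact (h c).compl
  have hfin : MeasurableSet {ω | (A ω).Finite} := by
    have : {ω | (A ω).Finite} = ⋃ F : Finset α, {ω | A ω = F} := by
      ext ω
      simp only [Set.mem_ofPred_eq, Set.mem_iUnion]
      exact ⟨fun hf => ⟨hf.toFinset, by simp⟩, fun ⟨F, hF⟩ => hF ▸ F.finite_toSet⟩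
    rw [this]
    exact MeasurableSet.iUnion hF
  refine measurable_to_countable' fun k => ?_
  -- Infinite sets have `ncard` equal to `0`, so they form an additional piece of the fibre over
  -- `0`.
  have : (fun ω => (A ω).ncard) ⁻¹' {k}
      = (⋃ F : {F : Finset α // F.card = k}, {ω | A ω = (F : Finset α)}) ∪
        {ω | ¬ (A ω).Finite ∧ k = 0} := by
    ext ω
    simp only [Set.mem_preimage, Set.mem_singleton_iff, Set.mem_union, Set.mem_iUnion,
      Set.mem_ofPred_eq]
    constructor
    · intro hk
      by_cases hf : (A ω).Finite
      · exact Or.inl ⟨⟨hf.toFinset, by rw [← hk, Set.ncard_eq_toFinset_card _ hf]⟩, by simp⟩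
      · exact Or.inr ⟨hf, by rw [← hk, Set.Infinite.ncard hf]⟩
    · rintro (⟨F, hF⟩ | ⟨hf, hk⟩)
      · rw [hF, Set.ncard_coe_finset, F.2]
      · rw [Set.Infinite.ncard hf, hk]
  rw [this]
  refine (MeasurableSet.iUnion fun F : {F : Finset α // F.card = k} => hF F.1).union ?_
  by_cases hk : k = 0
  · simp only [hk, and_true]; exact hfin.compl
  · simp [hk]

/-! ### The exponential law and its memorylessness. -/

section Exponential

variable {r : ℝ}

lemma integral_expMeasure (hr : 0 < r) (φ : ℝ → ℂ) :
    ∫ u, φ u ∂expMeasure r = ∫ u in Set.Ioi 0, (r * Real.exp (-(r * u)) : ℝ) * φ u := by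
  have h1 : expMeasure r = volume.withDensity (exponentialPDF r) := rfl
  rw [h1, integral_withDensity_eq_integral_toReal_smul]
  · rw [← integral_Ici_eq_integral_Ioi, ← integral_indicator measurableSet_Ici]
    refine integral_congr_ae (.of_forall fun u => ?_)
    simp only [exponentialPDF_eq, Set.indicator, Set.mem_Ici]
    split_ifs with h
    · rw [ENNReal.toReal_ofReal (by positivity)]; simp
    · simp
  · exact (measurable_exponentialPDFReal r).ennreal_ofReal
  · exact .of_forall fun u => ENNReal.ofReal_lt_top

lemma integral_expMeasure_memoryless (hr : 0 < r) {t : ℝ} (ht : 0 ≤ t) (φ : ℝ → ℂ) :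
    ∫ u, (if t < u then φ (u - t) else 0) ∂expMeasure r
      = Real.exp (-(r * t)) * ∫ u, φ u ∂expMeasure r := by
  rw [integral_expMeasure hr, integral_expMeasure hr, ← integral_const_mul,
    ← integral_indicator measurableSet_Ioi, ← integral_indicator measurableSet_Ioi,
    ← integral_add_right_eq_self _ t]
  refine integral_congr_ae (.of_forall fun u => ?_)
  simp only [Set.indicator, Set.mem_Ioi, lt_add_iff_pos_left, add_sub_cancel_right]
  by_cases hu : 0 < u
  · rw [if_pos (by linarith), if_pos hu, if_pos hu]
    rw [mul_add, neg_add, Real.exp_add]; push_cast; ring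
  · simp [hu]

lemma ae_expMeasure_pos (hr : 0 < r) : ∀ᵐ u ∂expMeasure r, 0 < u := by
  have := isProbabilityMeasure_expMeasure hr
  have h := cdf_expMeasure_eq hr 0
  rw [cdf_eq_real] at h
  simp only [le_refl, if_true, mul_zero, neg_zero, Real.exp_zero, sub_self] at h
  rw [ae_iff]
  simpa [measureReal_eq_zero_iff, Set.Iic] using h

lemma ae_expMeasure_ne (t : ℝ) : ∀ᵐ u ∂expMeasure r, u ≠ t := by
  have h1 : expMeasure r = volume.withDensity (exponentialPDF r) := rfl
  rw [h1]
  refine (withDensity_absolutelyContinuous _ _).ae_le ?_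
  exact volume.ae_ne t

end Exponential

/-! ### The Poisson process as a renewal process, restarted at a fixed time. -/

section Renewal

/-- The points of the renewal process with interarrival times `a`. -/
def pt (a : ℕ → ℝ) (m : ℕ) : ℝ := ∑ i ∈ Finset.range m, a i

/-- The number of points of the renewal process in `(t, t + d]`. -/
noncomputable def cnt (a : ℕ → ℝ) (t d : ℝ) : ℕ :=
  Set.ncard {j : ℕ | t < pt a (j + 1) ∧ pt a (j + 1) ≤ t + d}

@[fun_prop]
lemma measurable_pt (m : ℕ) : Measurable fun a : ℕ → ℝ => pt a m := by
  unfold pt; fun_prop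

lemma pt_succ (a : ℕ → ℝ) (m : ℕ) : pt a (m + 1) = pt a m + a m := Finset.sum_range_succ _ _

@[simp] lemma pt_zero (a : ℕ → ℝ) : pt a 0 = 0 := by simp [pt]

lemma pt_mono {a : ℕ → ℝ} (ha : ∀ i, 0 < a i) : Monotone (pt a) :=
  monotone_nat_of_le_succ fun m => by rw [pt_succ]; linarith [ha m]

lemma pt_nonneg {a : ℕ → ℝ} (ha : ∀ i, 0 < a i) (m : ℕ) : 0 ≤ pt a m :=
  pt_zero a ▸ pt_mono ha (Nat.zero_le m)

lemma pt_add (a : ℕ → ℝ) (m k : ℕ) : pt a (m + k) = pt a m + pt (fun i => a (m + i)) k :=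
  Finset.sum_range_add _ _ _

lemma pt_congr {a b : ℕ → ℝ} {m : ℕ} (h : ∀ i < m, a i = b i) : pt a m = pt b m :=
  Finset.sum_congr rfl fun i hi => h i (Finset.mem_range.1 hi)

lemma measurable_cnt {X : Type*} [MeasurableSpace X] {a : X → ℕ → ℝ} {t d : X → ℝ}
    (ha : Measurable a) (ht : Measurable t) (hd : Measurable d) :
    Measurable fun x => cnt (a x) (t x) (d x) := by
  refine measurable_ncard fun j => ?_
  have := (measurable_pt (j + 1)).comp ha
  exact (measurableSet_lt ht this).inter (measurableSet_le this (ht.add hd))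

variable {r : ℝ}

variable (r) in
/-- The law of a sequence of independent exponential random variables. -/
noncomputable abbrev expSeq : Measure (ℕ → ℝ) := Measure.infinitePi fun _ => expMeasure r

lemma ae_expSeq_pos (hr : 0 < r) : ∀ᵐ a ∂expSeq r, ∀ i, 0 < a i := by
  have := isProbabilityMeasure_expMeasure hr
  exact ae_all_iff.2 fun i => ae_infinitePi_eval i (ae_expMeasure_pos hr)

/-- With all times but the `j`-th frozen, a single value of that time is excluded, and the
exponential law has no atoms. This reconciles the glue periods `[g, g + G)` with the windows `(t, t
+ d]` of `cnt`. -/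
lemma ae_expSeq_pt_ne (hr : 0 < r) (t : ℝ) : ∀ᵐ a ∂expSeq r, ∀ j, pt a (j + 1) ≠ t := by
  have := isProbabilityMeasure_expMeasure hr
  refine ae_all_iff.2 fun j => ae_of_ae_mix {j} ?_ (.of_forall fun x => ?_)
  · exact (measurableSet_eq_fun (by fun_prop) (by fun_prop)).compl
  · filter_upwards [ae_infinitePi_eval (μ := fun _ => expMeasure r) j
      (ae_expMeasure_ne (t - pt x j))] with y hy h
    apply hy
    rw [pt_succ, mix_of_mem (Set.mem_singleton j), pt_congr (b := x)
      (fun i hi => mix_of_notMem (by simp [hi.ne]))] at h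
    linarith

/-- The chance that `n` consecutive times are at most `1` is a power `q ^ n` with `q < 1`. This is
all that is needed to exclude accumulation of points. -/
lemma ae_expSeq_exists_one_lt (hr : 0 < r) : ∀ᵐ a ∂expSeq r, ∀ k, ∃ i, k ≤ i ∧ 1 < a i := by
  have := isProbabilityMeasure_expMeasure hr
  refine ae_all_iff.2 fun k => ?_
  rw [ae_iff]
  have hq : (expMeasure r) (Set.Iic 1) < 1 := by
    have h := cdf_expMeasure_eq hr 1
    rw [cdf_eq_real, if_pos zero_le_one] at h
    have : (expMeasure r).real (Set.Iic 1) < 1 := by rw [h]; linarith [Real.exp_pos (-(r * 1))]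
    rw [← ENNReal.toReal_lt_toReal (measure_ne_top _ _) ENNReal.one_ne_top]
    simpa [measureReal_def] using this
  refine le_antisymm (ge_of_tendsto' (ENNReal.tendsto_pow_atTop_nhds_zero_of_lt_one hq)
    fun n => ?_) zero_le
  calc (expSeq r) {a | ¬∃ i, k ≤ i ∧ 1 < a i}
      ≤ (expSeq r) (Set.pi (Finset.Ico k (k + n)) fun _ => Set.Iic 1) := by
        refine measure_mono fun a ha i hi => ?_
        simp only [Set.mem_ofPred_eq, not_exists, not_and, not_lt] at ha
        exact ha i (by simpa using (Finset.mem_Ico.1 hi).1)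
    _ = _ := by
        rw [Measure.infinitePi_pi _ fun _ _ => measurableSet_Iic]
        simp

lemma ae_expSeq_finite (hr : 0 < r) : ∀ᵐ a ∂expSeq r, ∀ t, {j | pt a (j + 1) ≤ t}.Finite := by
  filter_upwards [ae_expSeq_pos hr, ae_expSeq_exists_one_lt hr] with a ha h1 t
  -- If the points were bounded, the interarrival times would be summable and hence eventually below
  -- `1`.
  obtain ⟨m, hm⟩ : ∃ m, t < pt a m := by
    by_contra! h
    have hs : Summable a := summable_of_sum_range_le (fun i => (ha i).le) h
    obtain ⟨k, hk⟩ := (hs.tendsto_atTop_zero.eventually (gt_mem_nhds zero_lt_one)).exists_forall_of_atTop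
    obtain ⟨i, hi, h1⟩ := h1 k
    exact absurd (hk i hi) (by linarith)
  refine (Set.finite_Iio m).subset fun j hj => ?_
  by_contra hjm
  have : m ≤ j + 1 := by simp only [Set.mem_Iio, not_lt] at hjm; omega
  exact absurd (hm.trans_le (pt_mono ha this)) (not_lt.2 hj)

/-- Resampling coordinate `0` alone reduces this to memorylessness of one exponential variable. -/
lemma integral_expSeq_memoryless (hr : 0 < r) {t : ℝ} (ht : 0 ≤ t) {Φ : (ℕ → ℝ) → ℂ}
    (hΦ : Measurable Φ) (hb : ∀ a, ‖Φ a‖ ≤ 1) :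
    ∫ a, (if t < a 0 then Φ (Function.update a 0 (a 0 - t)) else 0) ∂expSeq r
      = Real.exp (-(r * t)) * ∫ a, Φ a ∂expSeq r := by
  have := isProbabilityMeasure_expMeasure hr
  have hΦu : Measurable fun a : ℕ → ℝ => Φ (Function.update a 0 (a 0 - t)) := by
    refine hΦ.comp (measurable_pi_lambda _ fun i => ?_)
    by_cases hi : i = 0
    · subst hi; simp only [Function.update_self]; fun_prop
    · simp only [Function.update_of_ne hi]; fun_prop
  have hm : MeasurableSet {a : ℕ → ℝ | t < a 0} :=
    measurableSet_lt measurable_const (measurable_pi_apply 0)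
  rw [← integral_const_mul]
  refine integral_congr_mix {0} ?_ ?_ (.of_forall fun x => ?_)
  · refine Integrable.of_bound (C := 1) (Measurable.ite hm hΦu (by fun_prop)).aestronglyMeasurable
      (.of_forall fun a => ?_)
    split_ifs <;> simp [hb]
  · exact (Integrable.of_bound (C := 1) hΦ.aestronglyMeasurable (.of_forall hb)).const_mul _
  · have hmix : ∀ y : ℕ → ℝ, mix {0} x y = Function.update x 0 (y 0) := by
      intro y; ext i
      by_cases hi : i = 0
      · subst hi; simp [mix]
      · simp [mix, hi]
    have hup : Measurable fun u : ℝ => Function.update x 0 u := measurable_update x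
    simp only [hmix, Function.update_self, Function.update_idem]
    rw [integral_infinitePi_eval (μ := fun _ : ℕ => expMeasure r) 0
      (fun u => if t < u then Φ (Function.update x 0 (u - t)) else 0),
      integral_infinitePi_eval (μ := fun _ : ℕ => expMeasure r) 0
      (fun u => (Real.exp (-(r * t)) : ℂ) * Φ (Function.update x 0 u)),
      integral_expMeasure_memoryless hr ht fun u => Φ (Function.update x 0 u), integral_const_mul]
    · exact (hΦ.comp hup).const_mul _
    · exact Measurable.ite measurableSet_Ioi (hΦ.comp (hup.comp (measurable_id.sub_const t)))
        measurable_const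

/-- The interarrival times after time `t` of the renewal process `a`, if `m` points precede `t`. -/
noncomputable def residual (t : ℝ) (m : ℕ) (a : ℕ → ℝ) : ℕ → ℝ :=
  Function.update (fun k => a (m + k)) 0 (a m - (t - pt a m))

/-- The process `a` after its first `m` points are kept and the others are moved beyond `t`. -/
def stopped (t : ℝ) (m : ℕ) (a : ℕ → ℝ) : ℕ → ℝ := fun i => if i < m then a i else t + 1

/-- `Ψ` depends only on the points of the renewal process up to time `t`. -/
def AdaptedAt (t : ℝ) (Ψ : (ℕ → ℝ) → ℂ) : Prop :=
  ∀ a b : ℕ → ℝ, (∀ j, ∀ s ≤ t, pt a (j + 1) = s ↔ pt b (j + 1) = s) → Ψ a = Ψ b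

/-- The event that exactly the first `m` points are at most `t`. -/
def passage (t : ℝ) (m : ℕ) : Set (ℕ → ℝ) := {a | (∀ j ≤ m, pt a j ≤ t) ∧ t < pt a (m + 1)}

lemma measurableSet_passage (t : ℝ) (m : ℕ) : MeasurableSet (passage t m) := by
  refine MeasurableSet.inter ?_ (measurableSet_lt measurable_const (measurable_pt (m + 1)))
  have : {a : ℕ → ℝ | ∀ j ≤ m, pt a j ≤ t} = ⋂ j, ⋂ (_ : j ≤ m), {a | pt a j ≤ t} := by
    ext; simp
  change MeasurableSet {a : ℕ → ℝ | ∀ j ≤ m, pt a j ≤ t}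
  rw [this]
  exact MeasurableSet.iInter fun j => MeasurableSet.iInter fun _ =>
    measurableSet_le (by fun_prop) (by fun_prop)

/-- No positivity of the interarrival times is needed, because `passage` constrains all of the first
`m` points and not just the last of them. -/
lemma pairwise_disjoint_passage (t : ℝ) : Pairwise (Function.onFun Disjoint (passage t)) := by
  intro m k hmk
  wlog h : m < k generalizing m k
  · exact (this hmk.symm (by omega)).symm
  refine Set.disjoint_left.2 fun a ha hb => ?_
  exact absurd ha.2 (not_lt.2 (hb.1 (m + 1) h))

lemma exists_mem_passage {t : ℝ} (ht : 0 ≤ t) {a : ℕ → ℝ}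
    (hfin : {j | pt a (j + 1) ≤ t}.Finite) : ∃ m, a ∈ passage t m := by
  classical
  have hex : ∃ m, t < pt a (m + 1) := by
    obtain ⟨m, hm⟩ := hfin.exists_notMem
    exact ⟨m, by simpa using hm⟩
  refine ⟨Nat.find hex, ?_, Nat.find_spec hex⟩
  intro j hj
  rcases j with _ | j
  · simpa using ht
  · exact not_lt.1 (Nat.find_min hex hj)

lemma pt_residual (t : ℝ) (m : ℕ) (a : ℕ → ℝ) (k : ℕ) :
    t + pt (residual t m a) (k + 1) = pt a (m + k + 1) := by
  have h0 : residual t m a 0 = a m - (t - pt a m) := Function.update_self ..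
  have h1 : ∀ i, residual t m a (i + 1) = a (m + (i + 1)) := fun i =>
    Function.update_of_ne (Nat.succ_ne_zero i) _ _
  have h2 : pt (residual t m a) (k + 1) = ∑ i ∈ Finset.range k, a (m + (i + 1))
      + (a m - (t - pt a m)) := by
    rw [pt, Finset.sum_range_succ', h0, Finset.sum_congr rfl fun i _ => h1 i]
  have h3 : pt a (m + k + 1) = pt a m + (∑ i ∈ Finset.range k, a (m + (i + 1)) + a (m + 0)) := by
    rw [add_assoc, pt_add, pt.eq_1 (fun i => a (m + i)), Finset.sum_range_succ']
  rw [h2, h3]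
  simp only [add_zero]
  ring

lemma cnt_eq_cnt_residual {t d : ℝ} {m : ℕ} {a : ℕ → ℝ} (h : a ∈ passage t m) :
    cnt a t d = cnt (residual t m a) 0 d := by
  have : {j : ℕ | t < pt a (j + 1) ∧ pt a (j + 1) ≤ t + d}
      = (fun k => m + k) '' {j | 0 < pt (residual t m a) (j + 1) ∧
        pt (residual t m a) (j + 1) ≤ 0 + d} := by
    ext j
    simp only [Set.mem_ofPred_eq, Set.mem_image]
    constructor
    · intro hj
      have hmj : m ≤ j := by
        by_contra hlt
        exact absurd hj.1 (not_lt.2 (h.1 (j + 1) (by omega)))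
      refine ⟨j - m, ?_, by omega⟩
      have h2 := pt_residual t m a (j - m)
      rw [show m + (j - m) + 1 = j + 1 by omega] at h2
      constructor <;> linarith
    · rintro ⟨k, hk, rfl⟩
      have h2 := pt_residual t m a k
      constructor <;> linarith
  rw [cnt, this, Set.ncard_image_of_injective _ (add_right_injective m), cnt]

/-- Points beyond `t` may be moved without affecting `Ψ`. On `passage t m` this turns `Ψ` into a
function of the first `m` interarrival times only. -/
lemma AdaptedAt.eq_stopped {t : ℝ} {Ψ : (ℕ → ℝ) → ℂ} (hΨ : AdaptedAt t Ψ)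
    {m : ℕ} {a : ℕ → ℝ} (ha : ∀ i, 0 < a i) (ht : 0 ≤ t) (h : a ∈ passage t m) :
    Ψ a = Ψ (stopped t m a) := by
  refine hΨ _ _ fun j s hs => ?_
  by_cases hj : j + 1 ≤ m
  · rw [pt_congr (a := stopped t m a) (b := a) fun i hi => if_pos (by omega)]
  · have h1 : t < pt a (j + 1) := h.2.trans_le (pt_mono ha (by omega))
    have h2 : t < pt (stopped t m a) (j + 1) := by
      have hp : ∀ i, 0 < stopped t m a i := fun i => by
        unfold stopped; split_ifs; exacts [ha i, by linarith]
      refine lt_of_lt_of_le ?_ (pt_mono hp (show m + 1 ≤ j + 1 by omega))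
      rw [pt_succ, stopped, if_neg (lt_irrefl m)]
      linarith [pt_nonneg hp m]
    constructor <;> intro h' <;> linarith

lemma measurable_stopped (t : ℝ) (m : ℕ) : Measurable (stopped t m) := by
  refine measurable_pi_lambda _ fun i => ?_
  unfold stopped
  split_ifs <;> fun_prop

lemma measurable_residual (t : ℝ) (m : ℕ) : Measurable (residual t m) := by
  refine measurable_pi_lambda _ fun i => ?_
  unfold residual
  by_cases hi : i = 0
  · subst hi; simp only [Function.update_self]; fun_prop
  · simp only [Function.update_of_ne hi]; fun_prop

-- With the first `m` times frozen, `passage t m` says that the next one exceeds the remaining time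
-- `t - pt a m`; memorylessness then gives `residual` the law of a fresh process, at the cost of the
-- factor `exp (-(r * (t - pt a m)))`.
open Classical in
lemma integral_stopped_mul_residual (hr : 0 < r) {t : ℝ} {m : ℕ} {Ψ Φ : (ℕ → ℝ) → ℂ}
    (hΨ : Measurable Ψ) (hΨb : ∀ a, ‖Ψ a‖ ≤ 1) (hΦ : Measurable Φ) (hΦb : ∀ a, ‖Φ a‖ ≤ 1) :
    ∫ a in passage t m, Ψ (stopped t m a) * Φ (residual t m a) ∂expSeq r
      = (∫ a, (if ∀ j ≤ m, pt a j ≤ t then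
          Ψ (stopped t m a) * Real.exp (-(r * (t - pt a m))) else 0) ∂expSeq r)
        * ∫ a, Φ a ∂expSeq r := by
  have := isProbabilityMeasure_expMeasure hr
  have hm1 : MeasurableSet {a : ℕ → ℝ | ∀ j ≤ m, pt a j ≤ t} := by
    have : {a : ℕ → ℝ | ∀ j ≤ m, pt a j ≤ t} = ⋂ j, ⋂ (_ : j ≤ m), {a | pt a j ≤ t} := by
      ext; simp
    rw [this]
    exact MeasurableSet.iInter fun j => MeasurableSet.iInter fun _ =>
      measurableSet_le (by fun_prop) (by fun_prop)
  have hsm := measurable_stopped t m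
  have hrm := measurable_residual t m
  have hmeas : Measurable fun a => Ψ (stopped t m a) * Φ (residual t m a) :=
    (hΨ.comp hsm).mul (hΦ.comp hrm)
  have hnorm : ∀ a, ‖Ψ (stopped t m a) * Φ (residual t m a)‖ ≤ 1 := fun a => by
    rw [norm_mul]; exact mul_le_one₀ (hΨb _) (norm_nonneg _) (hΦb _)
  rw [← integral_indicator (measurableSet_passage t m), ← integral_mul_const]
  rw [integral_mix (Set.Ici m) (μ := fun _ : ℕ => expMeasure r)]
  swap
  · exact (Integrable.of_bound (C := 1) hmeas.aestronglyMeasurable (.of_forall hnorm)).indicator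
      (measurableSet_passage t m)
  refine integral_congr_ae (.of_forall fun x => ?_)
  dsimp only
  have hpt : ∀ y : ℕ → ℝ, ∀ j ≤ m, pt (mix (Set.Ici m) x y) j = pt x j := fun y j hj =>
    pt_congr fun i hi => mix_of_notMem (by simp; omega)
  have hst : ∀ y : ℕ → ℝ, stopped t m (mix (Set.Ici m) x y) = stopped t m x := fun y => by
    ext i
    unfold stopped
    split_ifs with h
    · exact mix_of_notMem (by simp; omega)
    · rfl
  have hres : ∀ y : ℕ → ℝ, residual t m (mix (Set.Ici m) x y)
      = (fun b : ℕ → ℝ => Function.update b 0 (b 0 - (t - pt x m))) (fun k => y (m + k)) := by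
    intro y
    ext i
    simp only [residual, hpt y m le_rfl, add_zero]
    rw [mix_of_mem (by simp : m ∈ Set.Ici m)]
    congr 1
    ext k
    exact mix_of_mem (by simp)
  have hmem : ∀ y : ℕ → ℝ, mix (Set.Ici m) x y ∈ passage t m ↔
      (∀ j ≤ m, pt x j ≤ t) ∧ t - pt x m < y (m + 0) := by
    intro y
    simp only [passage, Set.mem_ofPred_eq, pt_succ, hpt y m le_rfl, add_zero]
    rw [mix_of_mem (by simp : m ∈ Set.Ici m), sub_lt_iff_lt_add']
    exact and_congr_left fun _ => forall₂_congr fun j hj => by rw [hpt y j hj]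
  by_cases hx : ∀ j ≤ m, pt x j ≤ t
  · have hE : ∀ y : ℕ → ℝ, (passage t m).indicator
        (fun a => Ψ (stopped t m a) * Φ (residual t m a)) (mix (Set.Ici m) x y)
        = Ψ (stopped t m x) * (fun b : ℕ → ℝ => if t - pt x m < b 0 then
          Φ (Function.update b 0 (b 0 - (t - pt x m))) else 0) (fun k => y (m + k)) := by
      intro y
      by_cases h1 : t - pt x m < y (m + 0)
      · rw [Set.indicator_of_mem ((hmem y).2 ⟨hx, h1⟩), hst, hres]
        simp only [if_pos h1]
      · rw [Set.indicator_of_notMem fun h => h1 ((hmem y).1 h).2]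
        simp only [if_neg h1, mul_zero]
    simp only [hE]
    rw [integral_const_mul, if_pos hx, mul_assoc]
    congr 1
    have hup : Measurable fun b : ℕ → ℝ => Function.update b 0 (b 0 - (t - pt x m)) := by
      refine measurable_pi_lambda _ fun i => ?_
      by_cases hi : i = 0
      · subst hi; simp only [Function.update_self]; fun_prop
      · simp only [Function.update_of_ne hi]; fun_prop
    rw [integral_infinitePi_comp_injective (μ := fun _ : ℕ => expMeasure r)
      (add_right_injective m) (F := fun b : ℕ → ℝ => if t - pt x m < b 0 then
          Φ (Function.update b 0 (b 0 - (t - pt x m))) else 0)]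
    · exact integral_expSeq_memoryless hr (sub_nonneg.2 (hx m le_rfl)) hΦ hΦb
    · exact Measurable.ite (measurableSet_lt (by fun_prop) (by fun_prop)) (hΦ.comp hup)
        (by fun_prop)
  · simp [Set.indicator, hmem, hx]

/-- The strong form of memorylessness of the Poisson process at a fixed time `t`: what happens
after `t` is independent of what happened before, and has the law of the process itself. -/
lemma integral_adapted_mul_cnt (hr : 0 < r) {t : ℝ} (ht : 0 ≤ t) {Ψ : (ℕ → ℝ) → ℂ}
    (hΨ : Measurable Ψ) (hΨb : ∀ a, ‖Ψ a‖ ≤ 1) (had : AdaptedAt t Ψ) (d : ℝ) {ζ : ℂ}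
    (hζ : ‖ζ‖ ≤ 1) :
    ∫ a, Ψ a * ζ ^ cnt a t d ∂expSeq r
      = (∫ a, Ψ a ∂expSeq r) * ∫ a, ζ ^ cnt a 0 d ∂expSeq r := by
  have := isProbabilityMeasure_expMeasure hr
  have hpow : ∀ s, Measurable fun a : ℕ → ℝ => ζ ^ cnt a s d := fun s =>
    (measurable_from_nat (f := fun k => ζ ^ k)).comp
      (measurable_cnt measurable_id measurable_const measurable_const)
  have hpowb : ∀ k : ℕ, ‖ζ ^ k‖ ≤ 1 := fun k => by
    rw [norm_pow]; exact pow_le_one₀ (norm_nonneg _) hζ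
  rw [← integral_mul_const]
  refine integral_eq_of_countable_partition (measurableSet_passage t)
    (pairwise_disjoint_passage t) ?_ ?_ ?_ fun m => ?_
  · filter_upwards [ae_expSeq_finite hr] with a ha using exists_mem_passage ht (ha t)
  · refine Integrable.of_bound (C := 1) (hΨ.mul (hpow t)).aestronglyMeasurable
      (.of_forall fun a => ?_)
    rw [norm_mul]; exact mul_le_one₀ (hΨb _) (norm_nonneg _) (hpowb _)
  · exact (Integrable.of_bound (C := 1) hΨ.aestronglyMeasurable (.of_forall hΨb)).mul_const _
  · have hpos := ae_expSeq_pos hr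
    have h1 : ∫ a in passage t m, Ψ a * ζ ^ cnt a t d ∂expSeq r
        = ∫ a in passage t m, Ψ (stopped t m a) * ζ ^ cnt (residual t m a) 0 d ∂expSeq r := by
      refine setIntegral_congr_ae (measurableSet_passage t m) ?_
      filter_upwards [hpos] with a ha hmem
      rw [had.eq_stopped ha ht hmem, cnt_eq_cnt_residual hmem]
    -- The same factorisation with `Φ = 1` identifies the first factor, which therefore never has to
    -- be computed.
    have h2 : ∫ a in passage t m, Ψ a ∂expSeq r
        = ∫ a in passage t m, Ψ (stopped t m a) * 1 ∂expSeq r := by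
      refine setIntegral_congr_ae (measurableSet_passage t m) ?_
      filter_upwards [hpos] with a ha hmem
      rw [had.eq_stopped ha ht hmem, mul_one]
    rw [integral_mul_const, h1, h2,
      integral_stopped_mul_residual hr hΨ hΨb (hpow 0) (fun a => hpowb _),
      integral_stopped_mul_residual hr hΨ hΨb (Φ := fun _ => 1) measurable_const (by simp)]
    simp

end Renewal


/-! ### The Poisson generating function through the renewal equation. -/

/-- A locally bounded solution of `y(d) = 1 + κ ∫₀ᵈ y` is an exponential. -/
lemma eq_exp_of_integral_equation {y : ℝ → ℂ} {κ : ℂ} (hm : Measurable y) {M : ℝ → ℝ}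
    (hM : Monotone M) (hb : ∀ s, ‖y s‖ ≤ M s)
    (hy : ∀ d, 0 ≤ d → y d = 1 + κ * ∫ s in (0 : ℝ)..d, y s) {d : ℝ} (hd : 0 ≤ d) :
    y d = Complex.exp (κ * d) := by
  have hint : ∀ a b, IntervalIntegrable y volume a b := fun a b => by
    rw [intervalIntegrable_iff]
    refine Measure.integrableOn_of_bounded (M := M (max a b)) (by simp)
      hm.aestronglyMeasurable ?_
    filter_upwards [ae_restrict_mem measurableSet_uIoc] with s hs
    exact (hb s).trans (hM hs.2)
  have hYc : Continuous fun d => ∫ s in (0 : ℝ)..d, y s :=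
    intervalIntegral.continuous_primitive hint 0
  -- `y` is merely measurable, whereas `w` is continuous and equals `y` on `[0, ∞)`; so `w` is
  -- differentiable from the right there, and `w d * exp (-(κ * d))` has derivative zero.
  set w : ℝ → ℂ := fun d => 1 + κ * ∫ s in (0 : ℝ)..d, y s with hw
  have hwc : Continuous w := by fun_prop
  have hwy : ∀ d, 0 ≤ d → ∫ s in (0 : ℝ)..d, y s = ∫ s in (0 : ℝ)..d, w s := fun d hd =>
    intervalIntegral.integral_congr fun s hs => by
      rw [Set.uIcc_of_le hd] at hs; exact hy s hs.1
  have hder : ∀ x ∈ Set.Ico 0 d,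
      HasDerivWithinAt (fun d : ℝ => w d * Complex.exp (-(κ * d))) 0 (Set.Ici x) x := by
    intro x hx
    have h1 : HasDerivAt (fun d : ℝ => 1 + κ * ∫ s in (0 : ℝ)..d, w s) (κ * w x) x :=
      ((intervalIntegral.integral_hasDerivAt_right (hwc.intervalIntegrable _ _)
        hwc.stronglyMeasurable.stronglyMeasurableAtFilter hwc.continuousAt).const_mul κ).const_add 1
    have h2 : HasDerivWithinAt w (κ * w x) (Set.Ici x) x := by
      refine h1.hasDerivWithinAt.congr (fun s hs => ?_) ?_
      · rw [hw]; simp only [hwy s (hx.1.trans hs)]; rfl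
      · rw [hw]; simp only [hwy x hx.1]; rfl
    have h3 : HasDerivAt (fun d : ℝ => Complex.exp (-(κ * d)))
        (Complex.exp (-(κ * x)) * (-(κ * 1))) x :=
      ((((hasDerivAt_id (x : ℂ)).const_mul κ).neg).cexp).comp_ofReal
    refine (h2.mul h3.hasDerivWithinAt).congr_deriv ?_
    ring
  have hconst := constant_of_has_deriv_right_zero (a := 0) (b := d)
    (f := fun d : ℝ => w d * Complex.exp (-(κ * d))) (by fun_prop) hder d ⟨hd, le_rfl⟩
  have hw0 : w 0 = 1 := by simp [hw]
  simp only [hw0, Complex.ofReal_zero, mul_zero, neg_zero, Complex.exp_zero, mul_one] at hconst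
  rw [hy d hd, show 1 + κ * ∫ s in (0 : ℝ)..d, y s = w d from rfl]
  rw [Complex.exp_neg] at hconst
  field_simp [Complex.exp_ne_zero] at hconst
  exact hconst

variable {r : ℝ}

lemma cnt_eq_zero_of_lt {a : ℕ → ℝ} (ha : ∀ i, 0 < a i) {d : ℝ} (hd : d < a 0) :
    cnt a 0 d = 0 := by
  have : {j : ℕ | 0 < pt a (j + 1) ∧ pt a (j + 1) ≤ 0 + d} = ∅ := by
    refine Set.eq_empty_of_forall_notMem fun j hj => ?_
    have h1 := pt_mono ha (show 1 ≤ j + 1 by omega)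
    rw [pt_succ a 0, pt_zero] at h1
    linarith [hj.2]
  rw [cnt, this, Set.ncard_empty]

/-- Finiteness matters: an infinite set of points would have `ncard` equal to `0`. -/
lemma cnt_eq_succ {a : ℕ → ℝ} (ha : ∀ i, 0 < a i) (hfin : ∀ t, {j | pt a (j + 1) ≤ t}.Finite)
    {d : ℝ} (hd : a 0 ≤ d) : cnt a 0 d = cnt (fun k => a (1 + k)) 0 (d - a 0) + 1 := by
  have hpt : ∀ k, pt a (k + 1 + 1) = a 0 + pt (fun k => a (1 + k)) (k + 1) := fun k => by
    rw [show k + 1 + 1 = 1 + (k + 1) by omega, pt_add, pt_succ a 0, pt_zero, zero_add]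
  have h0 : pt a (0 + 1) = a 0 := by rw [pt_succ, pt_zero, zero_add]
  have : {j : ℕ | 0 < pt a (j + 1) ∧ pt a (j + 1) ≤ 0 + d}
      = insert 0 ((fun k => k + 1) '' {j : ℕ | 0 < pt (fun k => a (1 + k)) (j + 1) ∧
        pt (fun k => a (1 + k)) (j + 1) ≤ 0 + (d - a 0)}) := by
    ext j
    rcases j with _ | j
    · simp only [Set.mem_ofPred_eq, Set.mem_insert_iff, true_or, iff_true, h0]
      exact ⟨ha 0, by linarith⟩
    · simp only [Set.mem_ofPred_eq, Set.mem_insert_iff, Nat.add_eq_zero_iff, one_ne_zero, and_false,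
        false_or, Set.mem_image, Nat.add_right_cancel_iff, exists_eq_right, hpt]
      have h1 : 0 < pt (fun k => a (1 + k)) (j + 1) := by
        rw [pt_succ]
        have := pt_nonneg (a := fun k => a (1 + k)) (fun i => ha _) j
        linarith [ha (1 + j)]
      constructor
      · exact fun h => ⟨h1, by linarith [h.2]⟩
      · exact fun h => ⟨by linarith [ha 0], by linarith [h.2]⟩
  rw [cnt, this, Set.ncard_insert_of_notMem (by simp) (Set.Finite.image _
    (((hfin d).preimage (add_left_injective 1).injOn).subset fun j hj => ?_)), Set.ncard_image_of_injective _
    (add_left_injective 1), cnt]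
  simp only [Set.mem_preimage, Set.mem_ofPred_eq, hpt]
  linarith [hj.2]

lemma measurable_pow_cnt (ζ : ℂ) (t d : ℝ) : Measurable fun a : ℕ → ℝ => ζ ^ cnt a t d :=
  (measurable_from_nat (f := fun k => ζ ^ k)).comp
    (measurable_cnt measurable_id measurable_const measurable_const)

lemma norm_pow_le_one {ζ : ℂ} (hζ : ‖ζ‖ ≤ 1) (k : ℕ) : ‖ζ ^ k‖ ≤ 1 := by
  rw [norm_pow]; exact pow_le_one₀ (norm_nonneg _) hζ

lemma measurable_integral_pow_cnt (hr : 0 < r) (ζ : ℂ) :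
    Measurable fun d : ℝ => ∫ a, ζ ^ cnt a 0 d ∂expSeq r := by
  have := isProbabilityMeasure_expMeasure hr
  have hjoint : Measurable fun p : ℝ × (ℕ → ℝ) => ζ ^ cnt p.2 0 p.1 :=
    (measurable_from_nat (f := fun k => ζ ^ k)).comp
      (measurable_cnt measurable_snd measurable_const measurable_fst)
  exact (hjoint.stronglyMeasurable.integral_prod_right').measurable

lemma norm_integral_pow_cnt_le (hr : 0 < r) {ζ : ℂ} (hζ : ‖ζ‖ ≤ 1) (d : ℝ) :
    ‖∫ a, ζ ^ cnt a 0 d ∂expSeq r‖ ≤ 1 := by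
  have := isProbabilityMeasure_expMeasure hr
  simpa using norm_integral_le_of_norm_le_const (μ := expSeq r)
    (.of_forall fun a => norm_pow_le_one hζ (cnt a 0 d))

/-- The renewal equation at the first point of the process. -/
lemma integral_pow_cnt_renewal (hr : 0 < r) {ζ : ℂ} (hζ : ‖ζ‖ ≤ 1) {d : ℝ} :
    ∫ a, ζ ^ cnt a 0 d ∂expSeq r
      = ∫ u, (if d < u then 1 else ζ * ∫ a, ζ ^ cnt a 0 (d - u) ∂expSeq r) ∂expMeasure r := by
  have := isProbabilityMeasure_expMeasure hr
  have hcm := measurable_integral_pow_cnt hr ζ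
  rw [← integral_infinitePi_eval (μ := fun _ : ℕ => expMeasure r) 0
    (fun u => if d < u then 1 else ζ * ∫ a, ζ ^ cnt a 0 (d - u) ∂expSeq r)
    (Measurable.ite measurableSet_Ioi measurable_const
      ((hcm.comp (measurable_const.sub measurable_id)).const_mul ζ))]
  -- The first point `x 0` is frozen and the later times are resampled: after the first point the
  -- process starts afresh.
  rw [integral_mix (Set.Ici 1) (Integrable.of_bound (C := 1) (measurable_pow_cnt ζ 0 d).aestronglyMeasurable
    (.of_forall fun a => norm_pow_le_one hζ _))]
  refine integral_congr_ae ?_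
  filter_upwards [ae_mix (Set.Ici 1) (ae_expSeq_pos hr), ae_mix (Set.Ici 1) (ae_expSeq_finite hr)]
    with x hpos hfin
  have h0 : ∀ y : ℕ → ℝ, mix (Set.Ici 1) x y 0 = x 0 := fun y => mix_of_notMem (by simp)
  by_cases hx : d < x 0
  · simp only [hx, if_true]
    rw [integral_congr_ae (g := fun _ => 1)]
    · simp
    · filter_upwards [hpos] with y hy
      rw [cnt_eq_zero_of_lt hy (by rwa [h0]), pow_zero]
  · simp only [hx, if_false]
    rw [← integral_const_mul]
    have h2 := integral_infinitePi_comp_injective (μ := fun _ : ℕ => expMeasure r)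
      (add_right_injective 1) (F := fun a => ζ * ζ ^ cnt a 0 (d - x 0))
      ((measurable_pow_cnt ζ 0 (d - x 0)).const_mul ζ)
    refine Eq.trans (integral_congr_ae ?_) h2
    filter_upwards [hpos, hfin] with y hy hfy
    rw [cnt_eq_succ hy hfy (by rw [h0]; exact not_lt.1 hx), h0, pow_succ']
    congr 3
    ext k
    exact mix_of_mem (by simp)

/-- Splitting the exponential integral at `d`, substituting `s = d - u` and multiplying by `e^{rd}`
turns the convolution into a linear integral equation. -/
lemma exp_mul_eq_of_renewal (hr : 0 < r) {ζ : ℂ} (hζ : ‖ζ‖ ≤ 1) {c : ℝ → ℂ} (hcm : Measurable c)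
    (hcb : ∀ d, ‖c d‖ ≤ 1) {d : ℝ} (hd : 0 ≤ d)
    (hren : c d = ∫ u, (if d < u then 1 else ζ * c (d - u)) ∂expMeasure r) :
    Complex.exp (r * d) * c d
      = 1 + r * ζ * ∫ s in (0 : ℝ)..d, Complex.exp (r * s) * c s := by
  have := isProbabilityMeasure_expMeasure hr
  have hsplit : Set.Ioi (0 : ℝ) = Set.Ioc 0 d ∪ Set.Ioi d := (Set.Ioc_union_Ioi_eq_Ioi hd).symm
  have hF : Integrable (fun u => if d < u then (1 : ℂ) else ζ * c (d - u)) (expMeasure r) := by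
    refine Integrable.of_bound (C := 1) (Measurable.ite measurableSet_Ioi measurable_const
      ((hcm.comp (measurable_const.sub measurable_id)).const_mul ζ)).aestronglyMeasurable
      (.of_forall fun u => ?_)
    split_ifs
    · simp
    · rw [norm_mul]; exact mul_le_one₀ hζ (norm_nonneg _) (hcb _)
  have hexpint : IntegrableOn (fun u => r * Real.exp (-(r * u))) (Set.Ioi 0) := by
    have := (exp_neg_integrableOn_Ioi 0 hr).const_mul r
    simp only [neg_mul] at this
    exact this
  have hdens : IntegrableOn (fun u => ((r * Real.exp (-(r * u)) : ℝ) : ℂ)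
      * (if d < u then (1 : ℂ) else ζ * c (d - u))) (Set.Ioi 0) := by
    refine Integrable.mono' hexpint ?_ ?_
    · refine Measurable.aestronglyMeasurable ?_
      refine Measurable.mul (by fun_prop) ?_
      exact Measurable.ite measurableSet_Ioi measurable_const
        ((hcm.comp (measurable_const.sub measurable_id)).const_mul ζ)
    · refine .of_forall fun u => ?_
      rw [norm_mul, Complex.norm_real, Real.norm_of_nonneg (by positivity)]
      refine mul_le_of_le_one_right (by positivity) ?_
      split_ifs
      · simp
      · rw [norm_mul]; exact mul_le_one₀ hζ (norm_nonneg _) (hcb _)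
  rw [hren, integral_expMeasure hr, hsplit, setIntegral_union
    (Set.Ioc_disjoint_Ioi le_rfl) measurableSet_Ioi (hdens.mono_set (by rw [hsplit]; simp))
    (hdens.mono_set (by rw [hsplit]; simp))]
  have htail : ∫ u in Set.Ioi d, ((r * Real.exp (-(r * u)) : ℝ) : ℂ)
      * (if d < u then (1 : ℂ) else ζ * c (d - u)) = Real.exp (-(r * d)) := by
    rw [setIntegral_congr_fun (g := fun u => ((r * Real.exp (-(r * u)) : ℝ) : ℂ))
      measurableSet_Ioi (fun u hu => by simp [Set.mem_Ioi.1 hu])]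
    rw [integral_complex_ofReal]
    congr 1
    have h1 := integral_exp_mul_Ioi (a := -r) (by linarith) d
    simp only [neg_mul] at h1
    rw [integral_const_mul, h1]
    field_simp
  have hhead : ∫ u in Set.Ioc 0 d, ((r * Real.exp (-(r * u)) : ℝ) : ℂ)
      * (if d < u then (1 : ℂ) else ζ * c (d - u))
      = r * ζ * Complex.exp (-(r * d)) * ∫ s in (0 : ℝ)..d, Complex.exp (r * s) * c s := by
    rw [setIntegral_congr_fun (g := fun u => r * ζ * Complex.exp (-(r * d)) *
      (fun s : ℝ => Complex.exp (r * s) * c s) (d - u)) measurableSet_Ioc (fun u hu => ?_)]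
    · rw [integral_const_mul, ← intervalIntegral.integral_of_le hd,
        intervalIntegral.integral_comp_sub_left (fun s : ℝ => Complex.exp (r * s) * c s),
        sub_self, sub_zero]
    · simp only [not_lt.2 hu.2, if_false]
      push_cast
      rw [show -((r : ℂ) * u) = -(r * d) + r * (d - u) by ring, Complex.exp_add]
      ring
  rw [htail, hhead, mul_add, add_comm]
  push_cast
  rw [← Complex.exp_add, add_neg_cancel, Complex.exp_zero]
  congr 1
  calc _ = (Complex.exp (r * d) * Complex.exp (-(r * d))) * (r * ζ *
        ∫ s in (0 : ℝ)..d, Complex.exp (r * s) * c s) := by ring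
    _ = _ := by rw [← Complex.exp_add, add_neg_cancel, Complex.exp_zero, one_mul]

/-- `e^{rd} c(d)` solves the integral equation with `κ = rζ`, so it equals `e^{rζd}`; no law of a
partial sum is needed. -/
lemma integral_pow_cnt_zero (hr : 0 < r) {ζ : ℂ} (hζ : ‖ζ‖ ≤ 1) {d : ℝ} (hd : 0 ≤ d) :
    ∫ a, ζ ^ cnt a 0 d ∂expSeq r = Complex.exp (-(r * d * (1 - ζ))) := by
  obtain ⟨c, hc⟩ : ∃ c : ℝ → ℂ, c = fun d => ∫ a, ζ ^ cnt a 0 d ∂expSeq r := ⟨_, rfl⟩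
  have hcm : Measurable c := hc ▸ measurable_integral_pow_cnt hr ζ
  have hcb : ∀ d, ‖c d‖ ≤ 1 := fun d => by rw [hc]; exact norm_integral_pow_cnt_le hr hζ d
  have hexp : ∀ d : ℝ, 0 ≤ d → Complex.exp (r * d) * c d
      = 1 + r * ζ * ∫ s in (0 : ℝ)..d, Complex.exp (r * s) * c s := fun d hd =>
    exp_mul_eq_of_renewal hr hζ hcm hcb hd (by rw [hc]; exact integral_pow_cnt_renewal hr hζ)
  rw [show ∫ a, ζ ^ cnt a 0 d ∂expSeq r = c d by rw [hc]]
  have hfinal := eq_exp_of_integral_equation (y := fun d => Complex.exp (r * d) * c d)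
    (κ := r * ζ) (M := fun s => Real.exp (r * s)) (by fun_prop)
    (fun a b hab => Real.exp_le_exp.2 (by nlinarith)) (fun s => ?_) hexp hd
  · calc c d = Complex.exp (-(r * d)) * (Complex.exp (r * d) * c d) := by
          rw [← mul_assoc, ← Complex.exp_add, neg_add_cancel, Complex.exp_zero, one_mul]
      _ = _ := by
          rw [show Complex.exp (r * d) * c d = _ from hfinal, ← Complex.exp_add]; congr 1; ring
  · rw [norm_mul, Complex.norm_exp]
    simpa using mul_le_of_le_one_right (Real.exp_pos (r * s)).le (hcb s)

/-- The number of points of a Poisson process in `(t, t + d]` is Poisson, and independent of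
anything that depends only on the points up to time `t`. -/
lemma integral_adapted_mul_pow_cnt (hr : 0 < r) {t : ℝ} (ht : 0 ≤ t) {Ψ : (ℕ → ℝ) → ℂ}
    (hΨ : Measurable Ψ) (hΨb : ∀ a, ‖Ψ a‖ ≤ 1) (had : AdaptedAt t Ψ) {d : ℝ} (hd : 0 ≤ d) {ζ : ℂ}
    (hζ : ‖ζ‖ ≤ 1) :
    ∫ a, Ψ a * ζ ^ cnt a t d ∂expSeq r
      = Complex.exp (-(r * d * (1 - ζ))) * ∫ a, Ψ a ∂expSeq r := by
  rw [integral_adapted_mul_cnt hr ht hΨ hΨb had d hζ, integral_pow_cnt_zero hr hζ hd, mul_comm]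


/-! ### The canonical queue, its histories and its schedules. -/

/-- The queue whose driving variables are the coordinates of a point of `Source → ℝ`. -/
noncomputable def canon : Input (Source → ℝ) where
  initial x := ⌊x .initial⌋₊
  interarrival j x := x (.interarrival j)
  retrial c m x := x (.retrial c m)
  service c x := x (.service c)
  vacation n x := x (.vacation n)

/-- The evolution is a deterministic function of the driving variables; the floor in `canon` undoes
the cast of `I.initial` to the reals. -/
lemma Input.X_eq_canon {Ω : Type*} (I : Input Ω) (G : ℝ) (n : ℕ) (ω : Ω) :
    I.X G n ω = canon.X G n (fun s => I.driver s ω) := by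
  have hE : ∀ c, I.Exists ω c ↔ canon.Exists (fun s => I.driver s ω) c := by
    rintro (i | j)
    · simp [Input.Exists, canon, Input.driver]
    · rfl
  have hen : ∀ c, I.entry ω c = canon.entry (fun s => I.driver s ω) c := by
    rintro (i | j) <;> rfl
  have hA : ∀ c t, I.Attempt ω c t ↔ canon.Attempt (fun s => I.driver s ω) c t := by
    rintro (i | j) t <;> rfl
  have hC : ∀ n, I.cycle G ω n = canon.cycle G (fun s => I.driver s ω) n := by
    intro n
    induction n with
    | zero => rfl
    | succ n ih =>
      simp only [Input.cycle, ih, Input.glued, hE, hA]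
      rfl
  simp only [Input.X, hE, hen, hC]

variable (G : ℝ) (g : ℕ → ℝ)

/-- Customer `c` tries to join the queue during `[g k, g k + G)`. -/
def Tries (k : ℕ) (x : Source → ℝ) (c : Customer) : Prop :=
  ∃ t ∈ Set.Ico (g k) (g k + G), canon.Attempt x c t

/-- The customers who have not been glued before the `n`-th glue period, when the glue periods
start at the times `g k`. -/
def free (n : ℕ) (x : Source → ℝ) : Set Customer :=
  {c | canon.Exists x c ∧ ∀ k < n, ¬ Tries G g k x c}

/-- The customers who are glued in the `k`-th glue period. -/
def gluedAt (k : ℕ) (x : Source → ℝ) : Set Customer := {c | c ∈ free G g k x ∧ Tries G g k x c}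

/-- The customers who enter up to time `t` and are not glued before the `n`-th glue period. -/
def orbit (n : ℕ) (t : ℝ) (x : Source → ℝ) : Set Customer :=
  {c | c ∈ free G g n x ∧ canon.entry x c ≤ t}

/-- The customers glued in the `k`-th glue period are those in `q k`, for all `k < n`. -/
def History (q : ℕ → Finset Customer) (n : ℕ) (x : Source → ℝ) : Prop :=
  ∀ k < n, gluedAt G g k x = q k

/-- The starting times of the glue periods, if the customers in `q k` are served in the `k`-th
visit period. -/
def sched (q : ℕ → Finset Customer) (x : Source → ℝ) : ℕ → ℝ
  | 0 => 0
  | k + 1 => sched q x k + G + ∑ c ∈ q k, x (.service c) + x (.vacation k)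

variable {G g}

lemma tries_congr {g' : ℕ → ℝ} {k : ℕ} (h : g k = g' k) (x : Source → ℝ) (c : Customer) :
    Tries G g k x c ↔ Tries G g' k x c := by rw [Tries, Tries, h]

lemma free_congr {g' : ℕ → ℝ} {n : ℕ} (h : ∀ k < n, g k = g' k) (x : Source → ℝ) :
    free G g n x = free G g' n x := by
  ext c
  exact and_congr_right fun _ => forall₂_congr fun k hk => not_congr (tries_congr (h k hk) x c)

lemma gluedAt_congr {g' : ℕ → ℝ} {n : ℕ} (h : ∀ k ≤ n, g k = g' k) (x : Source → ℝ) :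
    gluedAt G g n x = gluedAt G g' n x := by
  ext c
  simp only [gluedAt, Set.mem_ofPred_eq]
  rw [free_congr (fun k hk => h k hk.le) x, tries_congr (h n le_rfl) x c]

lemma orbit_congr {g' : ℕ → ℝ} {n : ℕ} (h : ∀ k < n, g k = g' k) (t : ℝ) (x : Source → ℝ) :
    orbit G g n t x = orbit G g' n t x := by
  simp only [orbit, free_congr h x]

lemma history_congr {g' : ℕ → ℝ} {n : ℕ} (h : ∀ k < n, g k = g' k) (q : ℕ → Finset Customer)
    (x : Source → ℝ) : History G g q n x ↔ History G g' q n x :=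
  forall₂_congr fun k hk => by rw [gluedAt_congr (fun i hi => h i (hi.trans_lt hk))]

lemma disjoint_gluedAt {i k : ℕ} (h : i < k) (x : Source → ℝ) :
    Disjoint (gluedAt G g i x) (gluedAt G g k x) :=
  Set.disjoint_left.2 fun _ hi hk => hk.1.2 i h hi.2

lemma free_succ_compl (n : ℕ) (x : Source → ℝ) {c : Customer} (h : c ∈ free G g n x) :
    c ∈ free G g (n + 1) x ↔ ¬ Tries G g n x c := by
  constructor
  · exact fun h' => h'.2 n (Nat.lt_succ_self n)
  · exact fun h' => ⟨h.1, fun k hk => (Nat.lt_succ_iff_lt_or_eq.1 hk).elim (h.2 k)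
      fun e => e ▸ h'⟩

variable (G) in
/-- The starting times of the glue periods. -/
noncomputable def glueStart (x : Source → ℝ) (k : ℕ) : ℝ := (canon.cycle G x k).1

/-- Removes the recursion from the set of departed customers, so that the state depends on the
starting times alone. -/
lemma cycle_snd (x : Source → ℝ) (n : ℕ) : (canon.cycle G x n).2
    = {c | canon.Exists x c ∧ ∃ k < n, Tries G (glueStart G x) k x c} := by
  induction n with
  | zero => simp [Input.cycle]
  | succ n ih =>
    simp only [Input.cycle, Input.glued, ih]
    ext c
    simp only [Set.mem_union, Set.mem_ofPred_eq, Nat.lt_succ_iff_lt_or_eq, or_and_right, exists_or,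
      exists_eq_left]
    change _ ∨ canon.Exists x c ∧ _ ∧ Tries G (glueStart G x) n x c ↔ _
    by_cases h1 : canon.Exists x c <;> by_cases h2 : ∃ k < n, Tries G (glueStart G x) k x c <;>
      simp [h1, h2]

lemma cycle_glued (x : Source → ℝ) (n : ℕ) :
    canon.glued G x (canon.cycle G x n).1 (canon.cycle G x n).2 = gluedAt G (glueStart G x) n x := by
  ext c
  rw [cycle_snd]
  simp only [Input.glued, gluedAt, free, Set.mem_ofPred_eq]
  change canon.Exists x c ∧ _ ∧ Tries G (glueStart G x) n x c ↔ _
  constructor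
  · rintro ⟨h1, h2, h3⟩
    exact ⟨⟨h1, fun k hk h => h2 ⟨h1, k, hk, h⟩⟩, h3⟩
  · rintro ⟨⟨h1, h2⟩, h3⟩
    exact ⟨h1, fun ⟨_, k, hk, h⟩ => h2 k hk h, h3⟩

lemma X_canon (x : Source → ℝ) (n : ℕ) :
    canon.X G n x = (orbit G (glueStart G x) n (glueStart G x n) x).ncard := by
  rw [Input.X, cycle_snd]
  congr 1
  ext c
  simp only [orbit, free, Set.mem_ofPred_eq]
  change _ ∧ canon.entry x c ≤ glueStart G x n ∧ _ ↔ _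
  constructor
  · rintro ⟨h1, h2, h3⟩
    exact ⟨⟨h1, fun k hk h => h3 ⟨h1, k, hk, h⟩⟩, h2⟩
  · rintro ⟨⟨h1, h2⟩, h3⟩
    exact ⟨h1, h3, fun ⟨_, k, hk, h⟩ => h2 k hk h⟩

lemma glueStart_succ (x : Source → ℝ) {k : ℕ} {Q : Finset Customer}
    (h : gluedAt G (glueStart G x) k x = Q) :
    glueStart G x (k + 1) = glueStart G x k + G + ∑ c ∈ Q, x (.service c) + x (.vacation k) := by
  rw [sum_eq_tsum_indicator, ← h, ← cycle_glued]
  rfl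

lemma glueStart_eq_sched {q : ℕ → Finset Customer} {n : ℕ} {x : Source → ℝ}
    (h : History G (glueStart G x) q n x) : ∀ k ≤ n, glueStart G x k = sched G q x k := by
  intro k
  induction k with
  | zero => exact fun _ => rfl
  | succ k ih =>
      intro hk
      rw [glueStart_succ x (h k hk), sched, ih (Nat.le_of_succ_le hk)]

/-- The apparent circularity between schedule and history resolves by induction, since the glued set
of a period involves only the starting times up to that period. -/
lemma sched_eq_glueStart {q : ℕ → Finset Customer} {n : ℕ} {x : Source → ℝ}
    (h : History G (sched G q x) q n x) : ∀ k ≤ n, glueStart G x k = sched G q x k := by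
  induction n with
  | zero =>
    intro k hk
    obtain rfl : k = 0 := by omega
    rfl
  | succ n ih =>
    have ih := ih fun k hk => h k (hk.trans (Nat.lt_succ_self n))
    intro k hk
    rcases Nat.le_succ_iff.1 hk with hk | rfl
    · exact ih k hk
    · rw [glueStart_succ x ((gluedAt_congr ih x).trans (h n (Nat.lt_succ_self n))), sched,
        ih n le_rfl]

lemma history_sched_iff {q : ℕ → Finset Customer} {n : ℕ} {x : Source → ℝ} :
    History G (sched G q x) q n x ↔ History G (glueStart G x) q n x :=
  ⟨fun h => (history_congr (fun k hk => sched_eq_glueStart h k hk.le) q x).2 h,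
    fun h => (history_congr (fun k hk => glueStart_eq_sched h k hk.le) q x).1 h⟩

lemma X_canon_of_history {q : ℕ → Finset Customer} {n : ℕ} {x : Source → ℝ}
    (h : History G (sched G q x) q n x) :
    canon.X G n x = (orbit G (sched G q x) n (sched G q x n) x).ncard := by
  have := sched_eq_glueStart h
  rw [X_canon, orbit_congr (fun k hk => this k hk.le), this n le_rfl]


/-! ### Joint law and almost sure properties of the driving variables. -/

instance : Countable Customer := by
  refine Function.Injective.countable (β := ℕ ⊕ ℕ)
    (f := fun c => match c with | .initial i => .inl i | .arriving j => .inr j) ?_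
  rintro (i | i) (j | j) h <;> simp_all

instance : Countable Source := by
  refine Function.Injective.countable (β := Option (ℕ ⊕ (Customer × ℕ) ⊕ Customer ⊕ ℕ))
    (f := fun s => match s with
      | .initial => none | .interarrival j => some (.inl j)
      | .retrial c m => some (.inr (.inl (c, m))) | .service c => some (.inr (.inr (.inl c)))
      | .vacation n => some (.inr (.inr (.inr n)))) ?_
  rintro (_ | _ | _ | _ | _) (_ | _ | _ | _ | _) h <;> simp_all

/-- The interarrival times. -/
def arr (x : Source → ℝ) (j : ℕ) : ℝ := x (.interarrival j)

/-- The retrial intervals of customer `c`. -/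
def retr (x : Source → ℝ) (c : Customer) (m : ℕ) : ℝ := x (.retrial c m)

lemma entry_arriving (x : Source → ℝ) (j : ℕ) :
    canon.entry x (.arriving j) = pt (arr x) (j + 1) := rfl

lemma entry_initial (x : Source → ℝ) (i : ℕ) : canon.entry x (.initial i) = 0 := rfl

lemma tries_iff {G : ℝ} {g : ℕ → ℝ} {k : ℕ} {x : Source → ℝ} {c : Customer} :
    Tries G g k x c ↔ ((∃ j, c = .arriving j) ∧ canon.entry x c ∈ Set.Ico (g k) (g k + G)) ∨
      ∃ m, canon.entry x c + pt (retr x c) (m + 1) ∈ Set.Ico (g k) (g k + G) := by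
  rcases c with i | j
  · simp only [Tries, Input.Attempt, entry_initial, zero_add]
    constructor
    · rintro ⟨t, ht, m, rfl⟩
      exact Or.inr ⟨m, ht⟩
    · rintro (⟨⟨j, hj⟩, _⟩ | ⟨m, hm⟩)
      · cases hj
      · exact ⟨_, hm, m, rfl⟩
  · simp only [Tries, Input.Attempt]
    constructor
    · rintro ⟨t, ht, m, rfl⟩
      rcases m with _ | m
      · exact Or.inl ⟨⟨j, rfl⟩, by simpa using ht⟩
      · exact Or.inr ⟨m, ht⟩
    · rintro (⟨_, h⟩ | ⟨m, hm⟩)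
      · exact ⟨_, h, 0, by simp⟩
      · exact ⟨_, hm, m + 1, rfl⟩

/-- The properties that the driving variables have almost surely. -/
structure Good (x : Source → ℝ) : Prop where
  arr_pos : ∀ j, 0 < arr x j
  arr_finite : ∀ t, {j | pt (arr x) (j + 1) ≤ t}.Finite
  retr_pos : ∀ c m, 0 < retr x c m
  service_nonneg : ∀ c, 0 ≤ x (.service c)
  vacation_nonneg : ∀ n, 0 ≤ x (.vacation n)

lemma Good.entry_le_of_tries {x : Source → ℝ} (hx : Good x) {G : ℝ} {g : ℕ → ℝ} {k : ℕ}
    {c : Customer} (h : Tries G g k x c) : canon.entry x c < g k + G := by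
  rcases tries_iff.1 h with ⟨_, h⟩ | ⟨m, h⟩
  · exact h.2
  · linarith [h.2, pt_nonneg (hx.retr_pos c) (m + 1)]

lemma Good.finite_entered {x : Source → ℝ} (hx : Good x) (t : ℝ) :
    {c | canon.Exists x c ∧ canon.entry x c ≤ t}.Finite := by
  refine (((Set.finite_Iio (canon.initial x)).image Customer.initial).union
    ((hx.arr_finite t).image Customer.arriving)).subset ?_
  rintro (i | j) ⟨h1, h2⟩
  · exact Or.inl ⟨i, h1, rfl⟩
  · exact Or.inr ⟨j, h2, rfl⟩

section Law

variable (lam ν : ℝ) (N B S : Measure ℝ)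

/-- The laws of the driving variables; the law of the initial number of customers is `N`. -/
noncomputable def sourceLaw : Source → Measure ℝ
  | .initial => N
  | .interarrival _ => expMeasure lam
  | .retrial _ _ => expMeasure ν
  | .service _ => B
  | .vacation _ => S

/-- The joint law of the driving variables. -/
noncomputable abbrev jointLaw : Measure (Source → ℝ) :=
  Measure.infinitePi (sourceLaw lam ν N B S)

lemma isProbabilityMeasure_sourceLaw {lam ν : ℝ} (hlam : 0 < lam) (hν : 0 < ν) {N B S : Measure ℝ}
    [IsProbabilityMeasure N] [IsProbabilityMeasure B] [IsProbabilityMeasure S] (s : Source) :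
    IsProbabilityMeasure (sourceLaw lam ν N B S s) := by
  have := isProbabilityMeasure_expMeasure hlam
  have := isProbabilityMeasure_expMeasure hν
  cases s <;> simp only [sourceLaw] <;> infer_instance

variable {lam ν N B S} [∀ s, IsProbabilityMeasure (sourceLaw lam ν N B S s)]

lemma ae_arr {p : (ℕ → ℝ) → Prop} (h : ∀ᵐ a ∂expSeq lam, p a) :
    ∀ᵐ x ∂jointLaw lam ν N B S, p (arr x) :=
  ae_infinitePi_comp_injective (e := Source.interarrival) (fun _ _ h => by cases h; rfl) h

lemma ae_retr {p : (ℕ → ℝ) → Prop} (h : ∀ᵐ a ∂expSeq ν, p a) (c : Customer) :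
    ∀ᵐ x ∂jointLaw lam ν N B S, p (retr x c) :=
  ae_infinitePi_comp_injective (e := Source.retrial c) (fun _ _ h => by cases h; rfl) h

lemma integral_arr {F : (ℕ → ℝ) → ℂ} (hF : Measurable F) :
    ∫ x, F (arr x) ∂jointLaw lam ν N B S = ∫ a, F a ∂expSeq lam :=
  integral_infinitePi_comp_injective (e := Source.interarrival) (fun _ _ h => by cases h; rfl) hF

lemma integral_retr {F : (ℕ → ℝ) → ℂ} (hF : Measurable F) (c : Customer) :
    ∫ x, F (retr x c) ∂jointLaw lam ν N B S = ∫ a, F a ∂expSeq ν :=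
  integral_infinitePi_comp_injective (e := Source.retrial c) (fun _ _ h => by cases h; rfl) hF

lemma ae_good (hlam : 0 < lam) (hν : 0 < ν) (hB : ∀ᵐ u ∂B, 0 ≤ u) (hS : ∀ᵐ u ∂S, 0 ≤ u) :
    ∀ᵐ x ∂jointLaw lam ν N B S, Good x := by
  filter_upwards [ae_arr (ae_expSeq_pos hlam), ae_arr (ae_expSeq_finite hlam),
    ae_all_iff.2 fun c => ae_retr (ae_expSeq_pos hν) c,
    ae_all_iff.2 fun c => ae_infinitePi_eval (μ := sourceLaw lam ν N B S) (.service c) hB,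
    ae_all_iff.2 fun n => ae_infinitePi_eval (μ := sourceLaw lam ν N B S) (.vacation n) hS]
    with x h1 h2 h3 h4 h5
  exact ⟨h1, h2, h3, h4, h5⟩

end Law

/-! ### Measurability of the sets of customers. -/

section Measurability

variable {X : Type*} [MeasurableSpace X] {G : ℝ} {h : X → ℕ → ℝ} {x : X → Source → ℝ}

@[fun_prop]
lemma measurable_arr : Measurable arr := by unfold arr; fun_prop

@[fun_prop]
lemma measurable_retr (c : Customer) : Measurable fun x => retr x c := by unfold retr; fun_prop

@[fun_prop]
lemma measurable_entry (c : Customer) : Measurable fun x => canon.entry x c := by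
  rcases c with i | j
  · exact measurable_const
  · simp only [entry_arriving]; exact (measurable_pt _).comp measurable_arr

lemma measurableSet_exists (c : Customer) : MeasurableSet {x | canon.Exists x c} := by
  rcases c with i | j
  · exact measurableSet_lt measurable_const (Nat.measurable_floor.comp (measurable_pi_apply _))
  · exact MeasurableSet.univ

lemma measurableSet_tries (hh : ∀ k, Measurable fun p => h p k) (hx : Measurable x)
    (k : ℕ) (c : Customer) :
    MeasurableSet {p | Tries G (h p) k (x p) c} := by
  have he : Measurable fun p => canon.entry (x p) c := (measurable_entry c).comp hx
  have hk := hh k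
  have hIco : ∀ {u : X → ℝ}, Measurable u →
      MeasurableSet {p | u p ∈ Set.Ico (h p k) (h p k + G)} := fun hu =>
    (measurableSet_le hk hu).inter (measurableSet_lt hu (hk.add_const G))
  simp only [tries_iff]
  refine ((MeasurableSet.const _).inter (hIco he)).union ?_
  change MeasurableSet
    {p | ∃ m, canon.entry (x p) c + pt (retr (x p) c) (m + 1) ∈ Set.Ico (h p k) (h p k + G)}
  simp only [Set.ofPred_exists]
  exact MeasurableSet.iUnion fun m => hIco
    (he.add ((measurable_pt (m + 1)).comp ((measurable_retr c).comp hx)))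

lemma measurableSet_mem_free (hh : ∀ k, Measurable fun p => h p k) (hx : Measurable x)
    (n : ℕ) (c : Customer) :
    MeasurableSet {p | c ∈ free G (h p) n (x p)} := by
  refine (hx (measurableSet_exists c)).inter ?_
  have : {p | ∀ k < n, ¬ Tries G (h p) k (x p) c}
      = ⋂ k, ⋂ (_ : k < n), {p | Tries G (h p) k (x p) c}ᶜ := by ext; simp
  change MeasurableSet {p | ∀ k < n, ¬ Tries G (h p) k (x p) c}
  rw [this]
  exact MeasurableSet.iInter fun k => MeasurableSet.iInter fun _ =>
    (measurableSet_tries hh hx k c).compl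

lemma measurableSet_mem_gluedAt (hh : ∀ k, Measurable fun p => h p k) (hx : Measurable x)
    (n : ℕ) (c : Customer) :
    MeasurableSet {p | c ∈ gluedAt G (h p) n (x p)} :=
  (measurableSet_mem_free hh hx n c).inter (measurableSet_tries hh hx n c)

lemma measurableSet_mem_orbit (hh : ∀ k, Measurable fun p => h p k) (hx : Measurable x)
    (n : ℕ) {t : X → ℝ} (ht : Measurable t) (c : Customer) :
    MeasurableSet {p | c ∈ orbit G (h p) n (t p) (x p)} :=
  (measurableSet_mem_free hh hx n c).inter (measurableSet_le ((measurable_entry c).comp hx) ht)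

lemma measurableSet_gluedAt_eq (hh : ∀ k, Measurable fun p => h p k) (hx : Measurable x)
    (n : ℕ) (F : Set Customer) :
    MeasurableSet {p | gluedAt G (h p) n (x p) = F} := by
  have : {p | gluedAt G (h p) n (x p) = F} = ⋂ c, {p | c ∈ gluedAt G (h p) n (x p) ↔ c ∈ F} := by
    ext; simp [Set.ext_iff]
  rw [this]
  refine MeasurableSet.iInter fun c => ?_
  by_cases hc : c ∈ F
  · simp only [hc, iff_true]; exact measurableSet_mem_gluedAt hh hx n c
  · simp only [hc, iff_false]; exact (measurableSet_mem_gluedAt hh hx n c).compl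

lemma measurableSet_history (hh : ∀ k, Measurable fun p => h p k) (hx : Measurable x)
    (q : ℕ → Finset Customer) (n : ℕ) :
    MeasurableSet {p | History G (h p) q n (x p)} := by
  have : {p | History G (h p) q n (x p)}
      = ⋂ k, ⋂ (_ : k < n), {p | gluedAt G (h p) k (x p) = q k} := by
    ext; simp [History]
  rw [this]
  exact MeasurableSet.iInter fun k => MeasurableSet.iInter fun _ =>
    measurableSet_gluedAt_eq hh hx k (q k)

lemma measurable_pow_ncard_orbit (hh : ∀ k, Measurable fun p => h p k) (hx : Measurable x)
    (n : ℕ) {t : X → ℝ} (ht : Measurable t) (u : ℂ) :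
    Measurable fun p => u ^ (orbit G (h p) n (t p) (x p)).ncard :=
  (measurable_from_nat (f := fun k => u ^ k)).comp
    (measurable_ncard fun c => measurableSet_mem_orbit hh hx n ht c)

lemma measurable_pow_ncard_gluedAt (hh : ∀ k, Measurable fun p => h p k) (hx : Measurable x)
    (n : ℕ) (u : ℂ) :
    Measurable fun p => u ^ (gluedAt G (h p) n (x p)).ncard :=
  (measurable_from_nat (f := fun k => u ^ k)).comp
    (measurable_ncard fun c => measurableSet_mem_gluedAt hh hx n c)

end Measurability

open Classical in
/-- The indicator of a proposition. -/
noncomputable def ind (p : Prop) : ℂ := if p then 1 else 0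

lemma ind_of {p : Prop} (h : p) : ind p = 1 := if_pos h

lemma ind_of_not {p : Prop} (h : ¬ p) : ind p = 0 := if_neg h

lemma norm_ind_le (p : Prop) : ‖ind p‖ ≤ 1 := by unfold ind; split_ifs <;> simp

lemma measurable_ind {X : Type*} [MeasurableSpace X] {p : X → Prop} (h : MeasurableSet {x | p x}) :
    Measurable fun x => ind (p x) :=
  Measurable.ite h measurable_const measurable_const

lemma norm_mul_le_one {a b : ℂ} (ha : ‖a‖ ≤ 1) (hb : ‖b‖ ≤ 1) : ‖a * b‖ ≤ 1 := by
  rw [norm_mul]; exact mul_le_one₀ ha (norm_nonneg _) hb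

/-! ### Arrivals after a fixed time, for a fixed schedule. -/

section Arrivals

/-- The driving variables `x`, with the interarrival times replaced by `a`. -/
def putArr (x : Source → ℝ) (a : ℕ → ℝ) : Source → ℝ
  | .interarrival j => a j
  | s => x s

lemma measurable_putArr (x : Source → ℝ) : Measurable (putArr x) := by
  refine measurable_pi_lambda _ fun s => ?_
  cases s <;> simp only [putArr] <;> fun_prop

lemma mix_interarrival (x y : Source → ℝ) :
    mix (Set.range Source.interarrival) x y = putArr x (arr y) := by
  ext s
  cases s with
  | interarrival j => exact mix_of_mem ⟨j, rfl⟩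
  | _ => exact mix_of_notMem (by simp)

variable {G : ℝ} {g : ℕ → ℝ} {n : ℕ} {t : ℝ}

/-- Retrial intervals being positive, an attempt before `t` requires an entry before `t`, and the
entry times up to `t` are the same for `a` and `b`. -/
lemma tries_putArr_congr (hg : ∀ k < n, g k + G ≤ t) {x : Source → ℝ}
    (hx : ∀ c m, 0 < retr x c m) {a b : ℕ → ℝ}
    (hab : ∀ j, ∀ s ≤ t, pt a (j + 1) = s ↔ pt b (j + 1) = s) {k : ℕ} (hk : k < n) (c : Customer) :
    Tries G g k (putArr x a) c ↔ Tries G g k (putArr x b) c := by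
  wlog h : Tries G g k (putArr x a) c generalizing a b
  · by_cases h' : Tries G g k (putArr x b) c
    · exact (this (fun j s hs => (hab j s hs).symm) h').symm
    · exact iff_of_false h h'
  refine iff_of_true h ?_
  rcases c with i | j
  · exact h
  · have hret : ∀ a, retr (putArr x a) (.arriving j) = retr x (.arriving j) := fun a => rfl
    have hentry : ∀ a, canon.entry (putArr x a) (.arriving j) = pt a (j + 1) := fun a => rfl
    have hle : pt a (j + 1) ≤ t := by
      rcases tries_iff.1 h with ⟨_, h⟩ | ⟨m, h⟩
      · rw [hentry] at h; exact h.2.le.trans (hg k hk)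
      · rw [hentry, hret] at h
        linarith [h.2, hg k hk, pt_nonneg (hx (.arriving j)) (m + 1)]
    have hb : pt b (j + 1) = pt a (j + 1) := (hab j _ hle).1 rfl
    rw [tries_iff] at h ⊢
    rw [hentry, hret] at h ⊢
    rw [hb]
    exact h

lemma adaptedAt_history_orbit (hg : ∀ k < n, g k + G ≤ t) {x : Source → ℝ}
    (hx : ∀ c m, 0 < retr x c m) (q : ℕ → Finset Customer) (u : ℂ) :
    AdaptedAt t fun a => ind (History G g q n (putArr x a)) *
      u ^ (orbit G g n t (putArr x a)).ncard := by
  intro a b hab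
  have hE : ∀ c, canon.Exists (putArr x a) c ↔ canon.Exists (putArr x b) c := fun c => by
    cases c <;> rfl
  have htr : ∀ k < n, ∀ c, Tries G g k (putArr x a) c ↔ Tries G g k (putArr x b) c :=
    fun k hk c => tries_putArr_congr hg hx hab hk c
  have hfree : ∀ m ≤ n, free G g m (putArr x a) = free G g m (putArr x b) := by
    intro m hm
    ext c
    exact and_congr (hE c) (forall₂_congr fun k hk => not_congr (htr k (by omega) c))
  have hglued : ∀ k < n, gluedAt G g k (putArr x a) = gluedAt G g k (putArr x b) := by
    intro k hk
    ext c
    simp only [gluedAt, Set.mem_ofPred_eq]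
    rw [hfree k hk.le, htr k hk]
  have hentry : ∀ c, canon.entry (putArr x a) c ≤ t ↔ canon.entry (putArr x b) c ≤ t := by
    rintro (i | j)
    · rfl
    · change pt a (j + 1) ≤ t ↔ pt b (j + 1) ≤ t
      exact ⟨fun h => ((hab j _ h).1 rfl).trans_le h, fun h => ((hab j _ h).2 rfl).trans_le h⟩
  have h1 : History G g q n (putArr x a) ↔ History G g q n (putArr x b) :=
    forall₂_congr fun k hk => by rw [hglued k hk]
  have h2 : orbit G g n t (putArr x a) = orbit G g n t (putArr x b) := by
    ext c
    simp only [orbit, Set.mem_ofPred_eq]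
    rw [hfree n le_rfl, hentry]
  simp only [h1, h2]

variable {lam ν : ℝ} {N B S : Measure ℝ} [∀ s, IsProbabilityMeasure (sourceLaw lam ν N B S s)]

/-- For a fixed schedule of glue periods, the arrivals in `(t, t + d]` are independent of the
history and of the orbit up to time `t`. -/
lemma integral_history_orbit_mul_arrivals (hlam : 0 < lam) (hν : 0 < ν) (ht : 0 ≤ t)
    (hg : ∀ k < n, g k + G ≤ t) (q : ℕ → Finset Customer) {d : ℝ} (hd : 0 ≤ d) {u ζ : ℂ}
    (hu : ‖u‖ ≤ 1) (hζ : ‖ζ‖ ≤ 1) :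
    ∫ y, ind (History G g q n y) * u ^ (orbit G g n t y).ncard * ζ ^ cnt (arr y) t d
        ∂jointLaw lam ν N B S
      = Complex.exp (-(lam * d * (1 - ζ))) *
        ∫ y, ind (History G g q n y) * u ^ (orbit G g n t y).ncard ∂jointLaw lam ν N B S := by
  have hmeas : Measurable fun y => ind (History G g q n y) * u ^ (orbit G g n t y).ncard :=
    (measurable_ind (measurableSet_history (h := fun _ => g) (fun _ => measurable_const)
      measurable_id q n)).mul (measurable_pow_ncard_orbit (h := fun _ => g)
        (fun _ => measurable_const) measurable_id n measurable_const u)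
  have hb : ∀ y, ‖ind (History G g q n y) * u ^ (orbit G g n t y).ncard‖ ≤ 1 := fun y =>
    norm_mul_le_one (norm_ind_le _) (norm_pow_le_one hu _)
  rw [← integral_const_mul]
  refine integral_congr_mix (Set.range Source.interarrival) ?_ ?_ ?_
  · refine Integrable.of_bound (C := 1) (hmeas.mul
      ((measurable_pow_cnt ζ t d).comp measurable_arr)).aestronglyMeasurable
      (.of_forall fun y => norm_mul_le_one (hb y) (norm_pow_le_one hζ _))
  · exact (Integrable.of_bound (C := 1) hmeas.aestronglyMeasurable (.of_forall hb)).const_mul _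
  · filter_upwards [ae_all_iff.2 fun c => ae_retr (N := N) (B := B) (S := S) (lam := lam)
      (ae_expSeq_pos hν) c] with x hx
    have hmeas' := hmeas.comp (measurable_putArr x)
    have harr : ∀ a, arr (putArr x a) = a := fun a => rfl
    simp only [mix_interarrival, harr]
    rw [integral_arr (F := fun a => ind (History G g q n (putArr x a)) *
        u ^ (orbit G g n t (putArr x a)).ncard * ζ ^ cnt a t d)
        (hmeas'.mul (measurable_pow_cnt ζ t d)),
      integral_const_mul, integral_arr (F := fun a => ind (History G g q n (putArr x a)) *
        u ^ (orbit G g n t (putArr x a)).ncard) hmeas']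
    exact integral_adapted_mul_pow_cnt hlam ht hmeas' (fun a => hb _)
      (adaptedAt_history_orbit hg hx q u) hd hζ

end Arrivals


-- Turns a generating function into a product with one factor per customer.
open Classical in
lemma pow_ncard_eq_prod {κ : Type*} {A : Set κ} {C : Finset κ} (h : A ⊆ C) (z : ℂ) :
    z ^ A.ncard = ∏ c ∈ C, if c ∈ A then z else 1 := by
  have hA : A = ↑(C.filter (· ∈ A)) := by
    ext c; simpa using fun hc => h hc
  rw [Finset.prod_ite, Finset.prod_const, Finset.prod_const_one, mul_one]
  conv_lhs => rw [hA, Set.ncard_coe_finset]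

lemma ind_and (p q : Prop) : ind (p ∧ q) = ind p * ind q := by
  by_cases hp : p <;> by_cases hq : q <;> simp [ind, hp, hq]

lemma ind_forall_mem {κ : Type*} (C : Finset κ) (p : κ → Prop) :
    ind (∀ c ∈ C, p c) = ∏ c ∈ C, ind (p c) := by
  classical
  induction C using Finset.induction_on with
  | empty => simp [ind]
  | insert c C hc ih => rw [Finset.prod_insert hc, ← ih, ← ind_and, Finset.forall_mem_insert]

/-! ### Retrials during a glue period, customer by customer, for a fixed schedule. -/

section Retrials

variable {G : ℝ} {g : ℕ → ℝ} {q : ℕ → Finset Customer} {n : ℕ}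

variable (G g q n) in
/-- Customer `c` is glued for the first time in the `k`-th glue period if and only if it belongs
to `q k`, for all `k < n`. -/
def Consistent (x : Source → ℝ) (c : Customer) : Prop :=
  ∀ k < n, ((∀ i < k, ¬ Tries G g i x c) ∧ Tries G g k x c) ↔ c ∈ q k

open Classical in
variable (G g q n) in
/-- The contribution of customer `c` if those in orbit after the `n`-th glue period are weighted
by `z` and those glued in it by `w`. -/
noncomputable def weightAfter (z w : ℂ) (x : Source → ℝ) (c : Customer) : ℂ :=
  ind (Consistent G g q n x c) *
    if ∀ k < n, ¬ Tries G g k x c then (if Tries G g n x c then w else z) else 1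

open Classical in
variable (G g q n) in
/-- The contribution of customer `c` if those in orbit before the `n`-th glue period are weighted
by `u` and those who arrive during that period by `w`. -/
noncomputable def weightBefore (u w : ℂ) (x : Source → ℝ) (c : Customer) : ℂ :=
  ind (Consistent G g q n x c) *
    if ∀ k < n, ¬ Tries G g k x c then (if canon.entry x c ≤ g n then u else w) else 1

variable {x : Source → ℝ} {C : Finset Customer}

/-- A customer outside `C` enters too late to be glued before period `n`, or does not exist. What
remains is a condition on each customer separately, which makes independence of the retrials usable.
-/
lemma history_iff (hx : Good x) (hG : 0 < G) (hg : ∀ k < n, g k + G ≤ g n)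
    (hC : ∀ c, c ∈ C ↔ canon.Exists x c ∧ canon.entry x c ≤ g n + G) :
    History G g q n x ↔ (∀ k < n, q k ⊆ C) ∧ ∀ c ∈ C, Consistent G g q n x c := by
  constructor
  · intro h
    refine ⟨fun k hk c hc => ?_, fun c hc k hk => ?_⟩
    · have hc' : c ∈ gluedAt G g k x := by rw [h k hk]; exact hc
      exact (hC c).2 ⟨hc'.1.1, by linarith [hx.entry_le_of_tries hc'.2, hg k hk]⟩
    · rw [← Finset.mem_coe, ← h k hk]
      exact ⟨fun h' => ⟨⟨((hC c).1 hc).1, h'.1⟩, h'.2⟩, fun h' => ⟨h'.1.2, h'.2⟩⟩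
  · rintro ⟨h1, h2⟩ k hk
    ext c
    constructor
    · intro hc
      have hcC : c ∈ C := (hC c).2 ⟨hc.1.1, by linarith [hx.entry_le_of_tries hc.2, hg k hk]⟩
      exact (h2 c hcC k hk).1 ⟨hc.1.2, hc.2⟩
    · intro hc
      have hcC := h1 k hk hc
      obtain ⟨h3, h4⟩ := (h2 c hcC k hk).2 hc
      exact ⟨⟨((hC c).1 hcC).1, h3⟩, h4⟩

lemma ind_history_mul_after (hx : Good x) (hG : 0 < G) (hg : ∀ k < n, g k + G ≤ g n)
    (hC : ∀ c, c ∈ C ↔ canon.Exists x c ∧ canon.entry x c ≤ g n + G) (z w : ℂ) :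
    ind (History G g q n x) * (z ^ (orbit G g (n + 1) (g n + G) x).ncard *
        w ^ (gluedAt G g n x).ncard)
      = ind (∀ k < n, q k ⊆ C) * ∏ c ∈ C, weightAfter G g q n z w x c := by
  classical
  have h1 : orbit G g (n + 1) (g n + G) x ⊆ C := fun c hc => (hC c).2 ⟨hc.1.1, hc.2⟩
  have h2 : gluedAt G g n x ⊆ C := fun c hc =>
    (hC c).2 ⟨hc.1.1, (hx.entry_le_of_tries hc.2).le⟩
  rw [history_iff hx hG hg hC, ind_and, ind_forall_mem, mul_assoc, pow_ncard_eq_prod h1,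
    pow_ncard_eq_prod h2, ← Finset.prod_mul_distrib, ← Finset.prod_mul_distrib]
  congr 1
  refine Finset.prod_congr rfl fun c hc => ?_
  rw [weightAfter]
  congr 1
  have hc' := (hC c).1 hc
  by_cases hf : ∀ k < n, ¬ Tries G g k x c
  · have hfree : c ∈ free G g n x := ⟨hc'.1, hf⟩
    rw [if_pos hf]
    have e1 : c ∈ orbit G g (n + 1) (g n + G) x ↔ ¬ Tries G g n x c :=
      ⟨fun h => (free_succ_compl n x hfree).1 h.1, fun h => ⟨(free_succ_compl n x hfree).2 h, hc'.2⟩⟩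
    have e2 : c ∈ gluedAt G g n x ↔ Tries G g n x c := ⟨fun h => h.2, fun h => ⟨hfree, h⟩⟩
    simp only [e1, e2]
    by_cases ht : Tries G g n x c <;> simp [ht]
  · rw [if_neg hf]
    rw [if_neg fun h => hf fun k hk => h.1.2 k (by omega), if_neg fun h => hf h.1.2, mul_one]

lemma ind_history_mul_before (hx : Good x) (hG : 0 < G) (hg : ∀ k < n, g k + G ≤ g n)
    (hg0 : 0 ≤ g n)
    (hC : ∀ c, c ∈ C ↔ canon.Exists x c ∧ canon.entry x c ≤ g n + G) (u w : ℂ) :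
    ind (History G g q n x) * (u ^ (orbit G g n (g n) x).ncard * w ^ cnt (arr x) (g n) G)
      = ind (∀ k < n, q k ⊆ C) * ∏ c ∈ C, weightBefore G g q n u w x c := by
  classical
  have h1 : orbit G g n (g n) x ⊆ C := fun c hc => (hC c).2 ⟨hc.1.1, hc.2.trans (by linarith)⟩
  set D : Set Customer := {c | canon.Exists x c ∧ g n < canon.entry x c ∧
    canon.entry x c ≤ g n + G} with hD
  -- Initial customers enter at time `0 ≤ g n`, so `D` contains arriving ones only.
  have hcnt : cnt (arr x) (g n) G = D.ncard := by
    have : D = Customer.arriving '' {j | g n < pt (arr x) (j + 1) ∧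
        pt (arr x) (j + 1) ≤ g n + G} := by
      ext c
      rcases c with i | j
      · simp [hD, entry_initial, hg0.not_gt]
      · simp [hD, entry_arriving, Input.Exists]
    rw [this, Set.ncard_image_of_injective _ (fun _ _ h => by cases h; rfl), cnt]
  have h2 : D ⊆ C := fun c hc => (hC c).2 ⟨hc.1, hc.2.2⟩
  rw [history_iff hx hG hg hC, ind_and, ind_forall_mem, mul_assoc, pow_ncard_eq_prod h1, hcnt,
    pow_ncard_eq_prod h2, ← Finset.prod_mul_distrib, ← Finset.prod_mul_distrib]
  congr 1
  refine Finset.prod_congr rfl fun c hc => ?_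
  rw [weightBefore]
  congr 1
  have hc' := (hC c).1 hc
  by_cases he : canon.entry x c ≤ g n
  · rw [if_neg (show c ∉ D from fun h => absurd he (not_le.2 h.2.1)), mul_one, if_pos he]
    by_cases hf : ∀ k < n, ¬ Tries G g k x c
    · rw [if_pos hf, if_pos (show c ∈ orbit G g n (g n) x from ⟨⟨hc'.1, hf⟩, he⟩)]
    · rw [if_neg hf, if_neg fun h => hf h.1.2]
  -- A customer who enters after `g n` cannot have tried in an earlier glue period.
  · have hf : ∀ k < n, ¬ Tries G g k x c := fun k hk h => by
      linarith [hx.entry_le_of_tries h, hg k hk]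
    rw [if_neg fun h => he h.2, if_pos (show c ∈ D from ⟨hc'.1, not_le.1 he, hc'.2⟩), one_mul,
      if_pos hf, if_neg he]

lemma norm_weightAfter_le {z w : ℂ} (hz : ‖z‖ ≤ 1) (hw : ‖w‖ ≤ 1) (x : Source → ℝ) (c : Customer) :
    ‖weightAfter G g q n z w x c‖ ≤ 1 := by
  refine norm_mul_le_one (norm_ind_le _) ?_
  split_ifs <;> simp [hz, hw]

lemma norm_weightBefore_le {u w : ℂ} (hu : ‖u‖ ≤ 1) (hw : ‖w‖ ≤ 1) (x : Source → ℝ)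
    (c : Customer) : ‖weightBefore G g q n u w x c‖ ≤ 1 := by
  refine norm_mul_le_one (norm_ind_le _) ?_
  split_ifs <;> simp [hu, hw]

section WeightMeasurability

variable (G g q n)

lemma measurableSet_tries_const (k : ℕ) (c : Customer) : MeasurableSet {x | Tries G g k x c} :=
  measurableSet_tries (h := fun _ => g) (fun _ => measurable_const) measurable_id k c

lemma measurableSet_forall_not_tries (m : ℕ) (c : Customer) :
    MeasurableSet {x | ∀ k < m, ¬ Tries G g k x c} := by
  have : {x | ∀ k < m, ¬ Tries G g k x c} = ⋂ k, ⋂ (_ : k < m), {x | Tries G g k x c}ᶜ := by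
    ext; simp
  rw [this]
  exact MeasurableSet.iInter fun k => MeasurableSet.iInter fun _ =>
    (measurableSet_tries_const G g k c).compl

lemma measurableSet_consistent (c : Customer) : MeasurableSet {x | Consistent G g q n x c} := by
  have : {x | Consistent G g q n x c} = ⋂ k, ⋂ (_ : k < n),
      {x | ((∀ i < k, ¬ Tries G g i x c) ∧ Tries G g k x c) ↔ c ∈ q k} := by
    ext; simp [Consistent]
  rw [this]
  refine MeasurableSet.iInter fun k => MeasurableSet.iInter fun _ => ?_
  have h := (measurableSet_forall_not_tries G g k c).inter (measurableSet_tries_const G g k c)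
  by_cases hc : c ∈ q k
  · simp only [hc, iff_true]; exact h
  · simp only [hc, iff_false]; exact h.compl

lemma measurable_weightAfter (z w : ℂ) (c : Customer) :
    Measurable fun x => weightAfter G g q n z w x c :=
  (measurable_ind (measurableSet_consistent G g q n c)).mul
    (Measurable.ite (measurableSet_forall_not_tries G g n c)
      (Measurable.ite (measurableSet_tries_const G g n c) measurable_const measurable_const)
      measurable_const)

lemma measurable_weightBefore (u w : ℂ) (c : Customer) :
    Measurable fun x => weightBefore G g q n u w x c :=
  (measurable_ind (measurableSet_consistent G g q n c)).mul
    (Measurable.ite (measurableSet_forall_not_tries G g n c)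
      (Measurable.ite (measurableSet_le (measurable_entry c) measurable_const) measurable_const
        measurable_const) measurable_const)

end WeightMeasurability

lemma tries_congr_customer {x y : Source → ℝ} {c : Customer}
    (he : canon.entry x c = canon.entry y c) (hr : retr x c = retr y c) (k : ℕ) :
    Tries G g k x c ↔ Tries G g k y c := by rw [tries_iff, tries_iff, he, hr]

lemma consistent_congr {x y : Source → ℝ} {c : Customer}
    (he : canon.entry x c = canon.entry y c) (hr : retr x c = retr y c) :
    Consistent G g q n x c ↔ Consistent G g q n y c := by
  simp only [Consistent, tries_congr_customer he hr]

lemma weightAfter_congr {x y : Source → ℝ} {c : Customer}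
    (he : canon.entry x c = canon.entry y c) (hr : retr x c = retr y c) (z w : ℂ) :
    weightAfter G g q n z w x c = weightAfter G g q n z w y c := by
  classical
  have ht := fun k => tries_congr_customer (G := G) (g := g) he hr k
  rw [weightAfter, weightAfter, consistent_congr he hr]
  exact congrArg _ (if_congr (forall₂_congr fun k _ => not_congr (ht k))
    (if_congr (ht n) rfl rfl) rfl)

lemma weightBefore_congr {x y : Source → ℝ} {c : Customer}
    (he : canon.entry x c = canon.entry y c) (hr : retr x c = retr y c) (u w : ℂ) :
    weightBefore G g q n u w x c = weightBefore G g q n u w y c := by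
  classical
  have ht := fun k => tries_congr_customer (G := G) (g := g) he hr k
  rw [weightBefore, weightBefore, consistent_congr he hr, he]
  exact congrArg _ (if_congr (forall₂_congr fun k _ => not_congr (ht k)) rfl rfl)

/-- The sources of the retrial intervals. -/
def retrialSources : Set Source := {s | ∃ c m, s = .retrial c m}

lemma entry_mix_retrial (x y : Source → ℝ) (c : Customer) :
    canon.entry (mix retrialSources x y) c = canon.entry x c := by
  rcases c with i | j
  · rfl
  · exact Finset.sum_congr rfl fun i _ => mix_of_notMem (by simp [retrialSources])

lemma retr_mix_retrial (x y : Source → ℝ) (c : Customer) :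
    retr (mix retrialSources x y) c = retr y c :=
  funext fun m => mix_of_mem ⟨c, m, rfl⟩

lemma exists_mix_retrial (x y : Source → ℝ) (c : Customer) :
    canon.Exists (mix retrialSources x y) c ↔ canon.Exists x c := by
  rcases c with i | j
  · have : mix retrialSources x y Source.initial = x .initial :=
      mix_of_notMem (by simp [retrialSources])
    simp only [Input.Exists, canon, this]
  · exact Iff.rfl

variable {lam ν : ℝ} {N B S : Measure ℝ} [∀ s, IsProbabilityMeasure (sourceLaw lam ν N B S s)]

/-- The chance that a customer in orbit is not glued during a glue period is `e^{-νG}`,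
independently of the past. -/
lemma integral_weightAfter_eq_weightBefore (hν : 0 < ν) (hG : 0 < G)
    (hg : ∀ k < n, g k + G ≤ g n) {c : Customer}
    (hc : ∀ j, c = .arriving j → canon.entry x c ≠ g n ∧ canon.entry x c ≠ g n + G)
    (hc0 : canon.entry x c ≤ g n + G) (hinit : 0 ≤ g n) {z w u : ℂ}
    (hu : u = (1 - Real.exp (-(ν * G))) * w + Real.exp (-(ν * G)) * z) :
    ∫ y, weightAfter G g q n z w (mix retrialSources x y) c ∂jointLaw lam ν N B S
      = ∫ y, weightBefore G g q n u w (mix retrialSources x y) c ∂jointLaw lam ν N B S := by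
  classical
  -- For a customer prescribed to be glued earlier, both weights reduce to the indicator of
  -- consistency.
  by_cases hq : ∃ k < n, c ∈ q k
  · obtain ⟨k, hk, hck⟩ := hq
    refine integral_congr_ae (.of_forall fun y => ?_)
    simp only [weightAfter, weightBefore]
    by_cases hcons : Consistent G g q n (mix retrialSources x y) c
    · have hf : ¬ ∀ k < n, ¬ Tries G g k (mix retrialSources x y) c := fun h =>
        h k hk ((hcons k hk).2 hck).2
      rw [if_neg hf, if_neg hf]
    · rw [ind_of_not hcons, zero_mul, zero_mul]
  push Not at hq
  by_cases he : canon.entry x c ≤ g n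
  swap
  -- A customer who arrives during the glue period sticks on arrival, so both sides carry the weight
  -- `w`.
  · refine integral_congr_ae (.of_forall fun y => ?_)
    simp only [weightAfter, weightBefore]
    have ht : Tries G g n (mix retrialSources x y) c := by
      rw [tries_iff, entry_mix_retrial]
      rcases c with i | j
      · exact absurd hinit he
      · exact Or.inl ⟨⟨j, rfl⟩, (not_le.1 he).le, lt_of_le_of_ne hc0 (hc j rfl).2⟩
    rw [if_pos ht, entry_mix_retrial, if_neg he]
  have hcons : ∀ y, Consistent G g q n y c ↔ ∀ k < n, ¬ Tries G g k y c := by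
    intro y
    constructor
    · intro h k
      induction k using Nat.strong_induction_on with
      | _ k ih =>
        intro hk ht
        exact hq k hk ((h k hk).1 ⟨fun i hi => ih i hi (hi.trans hk), ht⟩)
    · exact fun h k hk => iff_of_false (fun h' => h k hk h'.2) (hq k hk)
  set e := canon.entry x c with hedef
  -- the indicator that `c` is not glued before, as a function of its retrial intervals
  set Ψ : (ℕ → ℝ) → ℂ := fun b => ind (∀ k < n, ¬ ((((∃ j, c = .arriving j) ∧
    e ∈ Set.Ico (g k) (g k + G)) ∨ ∃ m, e + pt b (m + 1) ∈ Set.Ico (g k) (g k + G)))) with hΨ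
  have htries : ∀ k y, Tries G g k (mix retrialSources x y) c ↔
      (((∃ j, c = .arriving j) ∧ e ∈ Set.Ico (g k) (g k + G)) ∨
        ∃ m, e + pt (retr y c) (m + 1) ∈ Set.Ico (g k) (g k + G)) := fun k y => by
    rw [tries_iff, entry_mix_retrial, retr_mix_retrial]
  have hΨm : Measurable Ψ := by
    refine measurable_ind ?_
    have : {b : ℕ → ℝ | ∀ k < n, ¬ ((((∃ j, c = .arriving j) ∧
        e ∈ Set.Ico (g k) (g k + G)) ∨ ∃ m, e + pt b (m + 1) ∈ Set.Ico (g k) (g k + G)))}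
        = ⋂ k, ⋂ (_ : k < n), ({b | (∃ j, c = .arriving j) ∧ e ∈ Set.Ico (g k) (g k + G)} ∪
          ⋃ m, {b | e + pt b (m + 1) ∈ Set.Ico (g k) (g k + G)})ᶜ := by
      ext b; simp
    rw [this]
    refine MeasurableSet.iInter fun k => MeasurableSet.iInter fun _ =>
      ((MeasurableSet.const _).union (MeasurableSet.iUnion fun m => ?_)).compl
    exact ((measurable_pt (m + 1)).const_add e) measurableSet_Ico
  -- The retrial process of `c` runs from its entry time `e`; the earlier glue periods end by time
  -- `g n - e` on that clock.
  have hΨad : AdaptedAt (g n - e) Ψ := by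
    intro a b hab
    have : ∀ k < n, (∃ m, e + pt a (m + 1) ∈ Set.Ico (g k) (g k + G)) ↔
        ∃ m, e + pt b (m + 1) ∈ Set.Ico (g k) (g k + G) := by
      intro k hk
      refine exists_congr fun m => ⟨fun h => ?_, fun h => ?_⟩
      · rwa [(hab m _ (by linarith [h.2, hg k hk])).1 rfl]
      · rwa [(hab m _ (by linarith [h.2, hg k hk])).2 rfl]
    simp only [hΨ]
    congr 1
    exact propext (forall₂_congr fun k hk => by rw [this k hk])
  have hΨb : ∀ a, ‖Ψ a‖ ≤ 1 := fun a => norm_ind_le _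
  have hbefore : ∀ y, weightBefore G g q n u w (mix retrialSources x y) c = Ψ (retr y c) * u := by
    intro y
    simp only [weightBefore, hcons, entry_mix_retrial, hΨ, htries]
    rw [← hedef, if_pos he]
    split_ifs with h
    · rfl
    · rw [ind_of_not h, zero_mul, zero_mul]
  -- `0 ^ cnt` is the indicator that no retrial falls in the glue period; the Poisson generating
  -- function at `ζ = 0` makes its mean `e^{-νG}`. The exceptional null set consists of retrials on
  -- the boundary and accumulating retrials.
  have hafter : ∀ᵐ y ∂jointLaw lam ν N B S, weightAfter G g q n z w (mix retrialSources x y) c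
      = Ψ (retr y c) * w + (z - w) * (Ψ (retr y c) * 0 ^ cnt (retr y c) (g n - e) G) := by
    filter_upwards [ae_retr (ae_expSeq_pt_ne hν (g n - e)) c,
      ae_retr (ae_expSeq_pt_ne hν (g n - e + G)) c, ae_retr (ae_expSeq_finite hν) c]
      with y h1 h2 h3
    have ht : Tries G g n (mix retrialSources x y) c ↔ cnt (retr y c) (g n - e) G ≠ 0 := by
      have hfin : {j : ℕ | g n - e < pt (retr y c) (j + 1) ∧
          pt (retr y c) (j + 1) ≤ g n - e + G}.Finite :=
        (h3 (g n - e + G)).subset fun j hj => hj.2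
      rw [htries, cnt, ← Nat.pos_iff_ne_zero, Set.ncard_pos hfin]
      constructor
      · rintro (⟨⟨j, hj⟩, h⟩ | ⟨m, h⟩)
        · exact absurd (le_antisymm he h.1) (hc j hj).1
        · exact ⟨m, lt_of_le_of_ne (by linarith [h.1]) (h1 m).symm, by linarith [h.2]⟩
      · rintro ⟨m, h⟩
        exact Or.inr ⟨m, by linarith [h.1], by linarith [lt_of_le_of_ne h.2 (h2 m)]⟩
    simp only [weightAfter, hcons, hΨ]
    simp only [← htries]
    by_cases hf : ∀ k < n, ¬ Tries G g k (mix retrialSources x y) c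
    · rw [if_pos hf, ind_of hf]
      by_cases htn : Tries G g n (mix retrialSources x y) c
      · rw [if_pos htn, zero_pow (ht.1 htn)]; ring
      · rw [if_neg htn, not_not.1 (mt ht.2 htn)]; ring
    · rw [ind_of_not hf]; ring
  have hmul : Measurable fun b => Ψ b * 0 ^ cnt b (g n - e) G :=
    hΨm.mul (measurable_pow_cnt 0 _ _)
  have hΨi : Integrable (fun y => Ψ (retr y c)) (jointLaw lam ν N B S) :=
    Integrable.of_bound (C := 1) (hΨm.comp (measurable_retr c)).aestronglyMeasurable
      (.of_forall fun y => hΨb _)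
  have hΨ0i : Integrable (fun y => Ψ (retr y c) * 0 ^ cnt (retr y c) (g n - e) G)
      (jointLaw lam ν N B S) :=
    Integrable.of_bound (C := 1) (hmul.comp (measurable_retr c)).aestronglyMeasurable
      (.of_forall fun y => norm_mul_le_one (hΨb _) (norm_pow_le_one (by simp) _))
  rw [integral_congr_ae hafter]
  simp only [hbefore]
  rw [integral_add (hΨi.mul_const _) (hΨ0i.const_mul _), integral_mul_const, integral_const_mul,
    integral_mul_const, integral_retr hΨm c, integral_retr hmul c,
    integral_adapted_mul_pow_cnt hν (by linarith) hΨm hΨb hΨad hG.le (by simp), hu]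
  push_cast
  rw [sub_zero, mul_one]
  ring

/-- For a fixed schedule of glue periods, each customer in orbit at the start of the `n`-th glue
period is glued in it with probability `1 - e^{-νG}`, independently of the others and of the
history. -/
lemma integral_history_orbit_glued (hlam : 0 < lam) (hν : 0 < ν) (hG : 0 < G)
    (hB : ∀ᵐ v ∂B, 0 ≤ v) (hS : ∀ᵐ v ∂S, 0 ≤ v)
    (hg : ∀ k < n, g k + G ≤ g n) (hg0 : 0 ≤ g n) {z w u : ℂ} (hz : ‖z‖ ≤ 1) (hw : ‖w‖ ≤ 1)
    (hu1 : ‖u‖ ≤ 1)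
    (hu : u = (1 - Real.exp (-(ν * G))) * w + Real.exp (-(ν * G)) * z) :
    ∫ y, ind (History G g q n y) * (z ^ (orbit G g (n + 1) (g n + G) y).ncard *
        w ^ (gluedAt G g n y).ncard) ∂jointLaw lam ν N B S
      = ∫ y, ind (History G g q n y) * (u ^ (orbit G g n (g n) y).ncard *
        w ^ cnt (arr y) (g n) G) ∂jointLaw lam ν N B S := by
  have hgm : ∀ k, Measurable fun _ : Source → ℝ => g k := fun _ => measurable_const
  have hH := measurable_ind (measurableSet_history (G := G) (h := fun _ => g) hgm measurable_id q n)
  refine integral_congr_mix retrialSources ?_ ?_ ?_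
  · refine Integrable.of_bound (C := 1) (hH.mul ((measurable_pow_ncard_orbit (h := fun _ => g) hgm
      measurable_id (n + 1) measurable_const z).mul (measurable_pow_ncard_gluedAt (h := fun _ => g)
        hgm measurable_id n w))).aestronglyMeasurable (.of_forall fun y => ?_)
    exact norm_mul_le_one (norm_ind_le _)
      (norm_mul_le_one (norm_pow_le_one hz _) (norm_pow_le_one hw _))
  · refine Integrable.of_bound (C := 1) (hH.mul ((measurable_pow_ncard_orbit (h := fun _ => g) hgm
      measurable_id n measurable_const u).mul
        ((measurable_pow_cnt w _ _).comp measurable_arr))).aestronglyMeasurable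
        (.of_forall fun y => ?_)
    exact norm_mul_le_one (norm_ind_le _)
      (norm_mul_le_one (norm_pow_le_one hu1 _) (norm_pow_le_one hw _))
  · filter_upwards [ae_good (N := N) hlam hν hB hS,
      ae_mix retrialSources (ae_good (N := N) hlam hν hB hS),
      ae_arr (ae_expSeq_pt_ne hlam (g n)), ae_arr (ae_expSeq_pt_ne hlam (g n + G))]
      with x hx hgood h1 h2
    -- Entry times do not involve retrials, so `C` stays fixed under the resampling.
    set C : Finset Customer := (hx.finite_entered (g n + G)).toFinset with hCdef
    have hC : ∀ y c, c ∈ C ↔ canon.Exists (mix retrialSources x y) c ∧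
        canon.entry (mix retrialSources x y) c ≤ g n + G := fun y c => by
      rw [exists_mix_retrial, entry_mix_retrial, hCdef, Set.Finite.mem_toFinset]
      rfl
    have hdisj : Pairwise (Function.onFun Disjoint fun c => Set.range (Source.retrial c)) := by
      intro c d hcd
      refine Set.disjoint_left.2 ?_
      rintro _ ⟨m, rfl⟩ ⟨k, hk⟩
      cases hk
      exact hcd rfl
    have hret : ∀ {y y' : Source → ℝ} {c : Customer},
        (∀ i ∈ Set.range (Source.retrial c), y i = y' i) →
        retr (mix retrialSources x y) c = retr (mix retrialSources x y') c := by
      intro y y' c h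
      rw [retr_mix_retrial, retr_mix_retrial]
      exact funext fun m => h _ ⟨m, rfl⟩
    rw [integral_congr_ae (hgood.mono fun y hy => ind_history_mul_after hy hG hg (hC y) z w),
      integral_congr_ae (hgood.mono fun y hy => ind_history_mul_before hy hG hg hg0 (hC y) u w),
      integral_const_mul, integral_const_mul]
    congr 1
    rw [integral_prod_of_dependsOn C hdisj
        (F := fun c y => weightAfter G g q n z w (mix retrialSources x y) c)
        (fun c y y' h => weightAfter_congr (by rw [entry_mix_retrial, entry_mix_retrial]) (hret h)
          z w)
        (fun c => (measurable_weightAfter G g q n z w c).comp (measurable_mix_right _ x))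
        (fun c y => norm_weightAfter_le hz hw _ c),
      integral_prod_of_dependsOn C hdisj
        (F := fun c y => weightBefore G g q n u w (mix retrialSources x y) c)
        (fun c y y' h => weightBefore_congr (by rw [entry_mix_retrial, entry_mix_retrial]) (hret h)
          u w)
        (fun c => (measurable_weightBefore G g q n u w c).comp (measurable_mix_right _ x))
        (fun c y => norm_weightBefore_le hu1 hw _ c)]
    refine Finset.prod_congr rfl fun c hc => ?_
    refine integral_weightAfter_eq_weightBefore hν hG hg ?_ ?_ hg0 hu
    · rintro j rfl
      exact ⟨h1 j, h2 j⟩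
    · have := ((hC x c).1 hc).2
      rwa [entry_mix_retrial] at this

end Retrials


/-! ### Schedules, and their independence of arrivals and retrials. -/

section Schedule

variable {G : ℝ} {q : ℕ → Finset Customer} {x y : Source → ℝ}

lemma sched_succ_ge (hx : Good x) (k : ℕ) : sched G q x k + G ≤ sched G q x (k + 1) := by
  have h1 : 0 ≤ ∑ c ∈ q k, x (.service c) := Finset.sum_nonneg fun c _ => hx.service_nonneg c
  have h2 := hx.vacation_nonneg k
  rw [sched]
  linarith

lemma sched_mono (hG : 0 < G) (hx : Good x) : Monotone (sched G q x) :=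
  monotone_nat_of_le_succ fun k => by linarith [sched_succ_ge (G := G) (q := q) hx k]

lemma sched_nonneg (hG : 0 < G) (hx : Good x) (k : ℕ) : 0 ≤ sched G q x k :=
  sched_mono (q := q) hG hx (Nat.zero_le k)

lemma sched_add_le (hG : 0 < G) (hx : Good x) {k n : ℕ} (h : k < n) :
    sched G q x k + G ≤ sched G q x n :=
  (sched_succ_ge hx k).trans (sched_mono hG hx h)

lemma sched_congr_of_agree {n : ℕ} (hs : ∀ k < n, ∀ c ∈ q k, x (.service c) = y (.service c))
    (hv : ∀ k < n, x (.vacation k) = y (.vacation k)) :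
    ∀ k ≤ n, sched G q x k = sched G q y k := by
  intro k
  induction k with
  | zero => exact fun _ => rfl
  | succ k ih =>
    intro hk
    rw [sched, sched, ih (by omega), hv k (by omega), Finset.sum_congr rfl (hs k (by omega))]

lemma sched_congr_history {q' : ℕ → Finset Customer} {n : ℕ} (h : ∀ k < n, q k = q' k) :
    ∀ k ≤ n, sched G q x k = sched G q' x k := by
  intro k
  induction k with
  | zero => exact fun _ => rfl
  | succ k ih =>
    intro hk
    rw [sched, sched, ih (by omega), h k (by omega)]

@[fun_prop]
lemma measurable_sched (k : ℕ) : Measurable fun x => sched G q x k := by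
  induction k with
  | zero => exact measurable_const
  | succ k ih => simp only [sched]; fun_prop

/-- The sources other than the service times and the vacations. -/
def dynamicSources : Set Source :=
  {s | (∀ c, s ≠ .service c) ∧ ∀ k, s ≠ .vacation k}

variable {g g' : ℕ → ℝ}

lemma tries_congr_of_agree (h : ∀ s ∈ dynamicSources, x s = y s) (k : ℕ) (c : Customer) :
    Tries G g k x c ↔ Tries G g k y c := by
  refine tries_congr_customer ?_ (funext fun m => h _ (by simp [dynamicSources])) k
  rcases c with i | j
  · rfl
  · exact Finset.sum_congr rfl fun i _ => h _ (by simp [dynamicSources])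

lemma free_congr_of_agree (h : ∀ s ∈ dynamicSources, x s = y s) (n : ℕ) :
    free G g n x = free G g n y := by
  ext c
  refine and_congr ?_ (forall₂_congr fun k _ => not_congr (tries_congr_of_agree h k c))
  rcases c with i | j
  · have : x .initial = y .initial := h _ (by simp [dynamicSources])
    simp only [Input.Exists, canon, this]
  · exact Iff.rfl

lemma gluedAt_congr_of_agree (h : ∀ s ∈ dynamicSources, x s = y s) (n : ℕ) :
    gluedAt G g n x = gluedAt G g n y := by
  ext c
  simp only [gluedAt, Set.mem_ofPred_eq]
  rw [free_congr_of_agree h, tries_congr_of_agree h]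

lemma history_congr_of_agree (h : ∀ s ∈ dynamicSources, x s = y s) (n : ℕ) :
    History G g q n x ↔ History G g q n y :=
  forall₂_congr fun k _ => by rw [gluedAt_congr_of_agree h]

lemma orbit_congr_of_agree (h : ∀ s ∈ dynamicSources, x s = y s) (n : ℕ) (t : ℝ) :
    orbit G g n t x = orbit G g n t y := by
  have he : ∀ c, canon.entry x c = canon.entry y c := by
    rintro (i | j)
    · rfl
    · exact Finset.sum_congr rfl fun i _ => h _ (by simp [dynamicSources])
  simp only [orbit, free_congr_of_agree h, he]

lemma mix_dynamic_agree (x y : Source → ℝ) : ∀ s ∈ dynamicSources, mix dynamicSources x y s = y s :=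
  fun _ h => mix_of_mem h

lemma sched_mix (x y : Source → ℝ) : sched G q (mix dynamicSources x y) = sched G q x :=
  funext fun k => sched_congr_of_agree (n := k)
    (fun _ _ _ _ => mix_of_notMem (by simp [dynamicSources]))
    (fun _ _ => mix_of_notMem (by simp [dynamicSources])) k le_rfl

/-- Whoever enters after `t` is too late for the glue periods that end by `t`, so every arrival in
`(t, t + d]` is in orbit. -/
lemma ncard_orbit_eq_add {n : ℕ} {t d : ℝ} (hx : Good x) (ht0 : 0 ≤ t)
    (ht : ∀ k < n, g k + G ≤ t) (hd : 0 ≤ d) :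
    (orbit G g n (t + d) x).ncard = (orbit G g n t x).ncard + cnt (arr x) t d := by
  have hU : orbit G g n (t + d) x = orbit G g n t x ∪
      Customer.arriving '' {j | t < pt (arr x) (j + 1) ∧ pt (arr x) (j + 1) ≤ t + d} := by
    ext c
    constructor
    · intro hc
      by_cases he : canon.entry x c ≤ t
      · exact Or.inl ⟨hc.1, he⟩
      · rcases c with i | j
        · exact absurd ht0 he
        · exact Or.inr ⟨j, ⟨not_le.1 he, hc.2⟩, rfl⟩
    · rintro (hc | ⟨j, hj, rfl⟩)
      · exact ⟨hc.1, by linarith [hc.2]⟩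
      · refine ⟨⟨trivial, fun k hk h => ?_⟩, hj.2⟩
        have h1 := hx.entry_le_of_tries h
        rw [entry_arriving] at h1
        linarith [hj.1, ht k hk]
  rw [hU, Set.ncard_union_eq ?_ ?_ ?_,
    Set.ncard_image_of_injective _ (fun _ _ h => by cases h; rfl), cnt]
  · refine Set.disjoint_left.2 ?_
    rintro _ hc ⟨j, hj, rfl⟩
    exact absurd hc.2 (not_le.2 hj.1)
  · exact (hx.finite_entered t).subset fun c hc => ⟨hc.1.1, hc.2⟩
  · exact ((hx.arr_finite (t + d)).subset fun j hj => hj.2).image _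

lemma finite_gluedAt (hx : Good x) (k : ℕ) : (gluedAt G g k x).Finite :=
  (hx.finite_entered (g k + G)).subset fun _ hc => ⟨hc.1.1, (hx.entry_le_of_tries hc.2).le⟩

end Schedule

/-! ### One cycle on a prescribed history. -/

section Recursion

variable {lam ν G : ℝ} {N B S : Measure ℝ} [∀ s, IsProbabilityMeasure (sourceLaw lam ν N B S s)]
variable {q : ℕ → Finset Customer} {n : ℕ}

lemma measurable_history_orbit (m n : ℕ) {t : (Source → ℝ) → ℝ} (ht : Measurable t) (z : ℂ) :
    Measurable fun x => ind (History G (sched G q x) q m x) *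
      z ^ (orbit G (sched G q x) n (t x) x).ncard :=
  (measurable_ind (measurableSet_history (fun k => measurable_sched k) measurable_id q m)).mul
    (measurable_pow_ncard_orbit (fun k => measurable_sched k) measurable_id n ht z)

lemma norm_history_orbit_le (g : ℕ → ℝ) (m n : ℕ) (t : ℝ) {z : ℂ} (hz : ‖z‖ ≤ 1) (x : Source → ℝ) :
    ‖ind (History G g q m x) * z ^ (orbit G g n t x).ncard‖ ≤ 1 :=
  norm_mul_le_one (norm_ind_le _) (norm_pow_le_one hz _)

variable (lam) in
/-- The transform of a nonnegative duration `v` at `lam (1 - z)`. -/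
noncomputable def durationWeight (z : ℂ) (v : ℝ) : ℂ := Complex.exp (-(lam * (1 - z) * (max v 0 : ℝ)))

/-- The truncation `max v 0` makes the bound hold everywhere and not just almost surely. -/
lemma norm_durationWeight_le (hlam : 0 < lam) {z : ℂ} (hz : ‖z‖ ≤ 1) (v : ℝ) :
    ‖durationWeight lam z v‖ ≤ 1 := by
  rw [durationWeight, Complex.norm_exp, Real.exp_le_one_iff]
  have h1 : z.re ≤ 1 := (Complex.re_le_norm z).trans hz
  simp only [Complex.neg_re, Complex.mul_re, Complex.ofReal_re, Complex.ofReal_im, Complex.sub_re,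
    Complex.one_re, mul_zero, sub_zero, zero_mul]
  have : 0 ≤ lam * (1 - z.re) * max v 0 := by
    have := le_max_right v 0
    have : 0 ≤ 1 - z.re := by linarith
    positivity
  linarith

@[fun_prop]
lemma measurable_durationWeight (z : ℂ) : Measurable (durationWeight lam z) := by
  unfold durationWeight; fun_prop

lemma integral_durationWeight {μ : Measure ℝ} (hμ : ∀ᵐ v ∂μ, 0 ≤ v) (z : ℂ) :
    ∫ v, durationWeight lam z v ∂μ = arrivalsPGF lam μ z := by
  refine integral_congr_ae (hμ.mono fun v hv => ?_)
  simp only [durationWeight, max_eq_left hv]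

/-- With the durations frozen, the visit and the vacation last a known time `d`. The Poisson
arrivals in it contribute `e^{-λ(1-z)d}`, which splits into one factor per service and one for the
vacation. -/
lemma integral_history_orbit_next (hlam : 0 < lam) (hν : 0 < ν) (hG : 0 < G)
    (hB : ∀ᵐ v ∂B, 0 ≤ v) (hS : ∀ᵐ v ∂S, 0 ≤ v) {z : ℂ} (hz : ‖z‖ ≤ 1) :
    ∫ x, ind (History G (sched G q x) q (n + 1) x) *
        z ^ (orbit G (sched G q x) (n + 1) (sched G q x (n + 1)) x).ncard ∂jointLaw lam ν N B S
      = ∫ x, (∏ c ∈ q n, durationWeight lam z (x (.service c))) *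
          (durationWeight lam z (x (.vacation n)) * (ind (History G (sched G q x) q (n + 1) x) *
          z ^ (orbit G (sched G q x) (n + 1) (sched G q x n + G) x).ncard))
          ∂jointLaw lam ν N B S := by
  have hm2 := measurable_history_orbit (G := G) (q := q) (n + 1) (n + 1)
    (t := fun x => sched G q x n + G) (by fun_prop) z
  refine integral_congr_mix dynamicSources ?_ ?_ ?_
  · exact Integrable.of_bound (C := 1) (measurable_history_orbit _ _
      (measurable_sched (n + 1)) z).aestronglyMeasurable
      (.of_forall fun x => norm_history_orbit_le _ _ _ _ hz x)
  · refine Integrable.of_bound (C := 1) (Measurable.mul (by fun_prop)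
      (Measurable.mul (by fun_prop) hm2)).aestronglyMeasurable (.of_forall fun x => ?_)
    refine norm_mul_le_one ?_ (norm_mul_le_one (norm_durationWeight_le hlam hz _)
      (norm_history_orbit_le _ _ _ _ hz x))
    rw [norm_prod]
    exact Finset.prod_le_one (fun _ _ => norm_nonneg _) fun _ _ => norm_durationWeight_le hlam hz _
  · filter_upwards [ae_good (N := N) hlam hν hB hS] with x hx
    have hserv : ∀ y c, mix dynamicSources x y (.service c) = x (.service c) := fun y c =>
      mix_of_notMem (by simp [dynamicSources])
    have hvac : ∀ y k, mix dynamicSources x y (.vacation k) = x (.vacation k) := fun y k =>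
      mix_of_notMem (by simp [dynamicSources])
    simp only [sched_mix, history_congr_of_agree (mix_dynamic_agree x _),
      orbit_congr_of_agree (mix_dynamic_agree x _), hserv, hvac]
    set g := sched G q x with hgdef
    set d := ∑ c ∈ q n, x (.service c) + x (.vacation n) with hd
    have hd0 : 0 ≤ d := add_nonneg (Finset.sum_nonneg fun c _ => hx.service_nonneg c)
      (hx.vacation_nonneg n)
    have hgn : g (n + 1) = g n + G + d := by rw [hgdef, sched, hd]; ring
    have hgk : ∀ k < n + 1, g k + G ≤ g n + G := fun k hk => by
      linarith [sched_mono (q := q) hG hx (Nat.lt_succ_iff.1 hk)]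
    have ht0 : 0 ≤ g n + G := by linarith [sched_nonneg (q := q) hG hx n]
    have hL : ∫ y, ind (History G g q (n + 1) y) * z ^ (orbit G g (n + 1) (g (n + 1)) y).ncard
        ∂jointLaw lam ν N B S
        = ∫ y, ind (History G g q (n + 1) y) * z ^ (orbit G g (n + 1) (g n + G) y).ncard *
          z ^ cnt (arr y) (g n + G) d ∂jointLaw lam ν N B S := by
      refine integral_congr_ae ((ae_good hlam hν hB hS).mono fun y hy => ?_)
      dsimp only
      rw [hgn, ncard_orbit_eq_add hy ht0 hgk hd0, pow_add, mul_assoc]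
    rw [hL, integral_history_orbit_mul_arrivals hlam hν ht0 hgk q hd0 hz hz, integral_const_mul,
      integral_const_mul, ← mul_assoc]
    congr 1
    simp only [durationWeight, max_eq_left (hx.service_nonneg _),
      max_eq_left (hx.vacation_nonneg _)]
    rw [← Complex.exp_sum, ← Complex.exp_add, hd]
    congr 1
    push_cast
    rw [Finset.sum_neg_distrib, ← Finset.mul_sum]
    ring

lemma history_orbit_congr {x y : Source → ℝ} (h : ∀ s ∈ dynamicSources, x s = y s)
    (hs : ∀ k ≤ n, sched G q x k = sched G q y k) (z : ℂ) :
    ind (History G (sched G q x) q (n + 1) x) *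
        z ^ (orbit G (sched G q x) (n + 1) (sched G q x n + G) x).ncard
      = ind (History G (sched G q y) q (n + 1) y) *
        z ^ (orbit G (sched G q y) (n + 1) (sched G q y n + G) y).ncard := by
  rw [hs n le_rfl, history_congr_of_agree h, orbit_congr_of_agree h,
    history_congr (fun k hk => hs k (Nat.lt_succ_iff.1 hk)),
    orbit_congr (fun k hk => hs k (Nat.lt_succ_iff.1 hk))]

/-- The service times of the customers glued in the `n`-th glue period and the vacation after it
are independent of the history up to the end of that glue period. -/
lemma integral_durations_mul_history (hlam : 0 < lam)
    (hB : ∀ᵐ v ∂B, 0 ≤ v) (hS : ∀ᵐ v ∂S, 0 ≤ v) {z : ℂ} (hz : ‖z‖ ≤ 1) :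
    ∫ x, (∏ c ∈ q n, durationWeight lam z (x (.service c))) *
          (durationWeight lam z (x (.vacation n)) * (ind (History G (sched G q x) q (n + 1) x) *
          z ^ (orbit G (sched G q x) (n + 1) (sched G q x n + G) x).ncard))
          ∂jointLaw lam ν N B S
      = arrivalsPGF lam B z ^ (q n).card * (arrivalsPGF lam S z *
        ∫ x, ind (History G (sched G q x) q (n + 1) x) *
          z ^ (orbit G (sched G q x) (n + 1) (sched G q x n + G) x).ncard
          ∂jointLaw lam ν N B S) := by
  -- Nobody is glued twice, so if `q n` meets an earlier `q k` both sides vanish. Otherwise the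
  -- service times of `q n` do not enter the schedule up to period `n`, and independence applies.
  by_cases hdisj : ∃ k < n, ¬ Disjoint (q k) (q n)
  · obtain ⟨k, hk, hkn⟩ := hdisj
    have h0 : ∀ x, ind (History G (sched G q x) q (n + 1) x) = 0 := fun x => by
      refine ind_of_not fun h => hkn ?_
      rw [← Finset.disjoint_coe, ← h k (by omega), ← h n (by omega)]
      exact disjoint_gluedAt hk x
    simp [h0]
  push Not at hdisj
  have hm2 := measurable_history_orbit (G := G) (q := q) (n + 1) (n + 1)
    (t := fun x => sched G q x n + G) (by fun_prop) z
  have hvm : Measurable fun x : Source → ℝ => durationWeight lam z (x (.vacation n)) := by fun_prop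
  have hHb : ∀ x, ‖durationWeight lam z (x (.vacation n)) *
      (ind (History G (sched G q x) q (n + 1) x) *
          z ^ (orbit G (sched G q x) (n + 1) (sched G q x n + G) x).ncard)‖ ≤ 1 := fun x =>
    norm_mul_le_one (norm_durationWeight_le hlam hz _) (norm_history_orbit_le _ _ _ _ hz x)
  rw [integral_mul_of_dependsOn (s := {s | ∃ c ∈ q n, s = .service c}),
    integral_mul_of_dependsOn (s := {.vacation n})]
  · congr 1
    · rw [integral_prod_of_dependsOn (q n) (s := fun c => {Source.service c})
        (F := fun c x => durationWeight lam z (x (.service c)))]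
      · rw [← Finset.prod_const]
        refine Finset.prod_congr rfl fun c _ => ?_
        rw [integral_infinitePi_eval (μ := sourceLaw lam ν N B S) (.service c)
          (durationWeight lam z) (by fun_prop)]
        exact integral_durationWeight hB z
      · intro c d hcd
        simp only [Function.onFun, Set.disjoint_singleton]
        intro h
        cases h
        exact hcd rfl
      · intro c x y h
        dsimp only
        rw [h (.service c) rfl]
      · fun_prop
      · exact fun c x => norm_durationWeight_le hlam hz _
    · congr 1
      rw [integral_infinitePi_eval (μ := sourceLaw lam ν N B S) (.vacation n)
        (durationWeight lam z) (by fun_prop)]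
      exact integral_durationWeight hS z
  · intro x y h
    dsimp only
    rw [h (.vacation n) rfl]
  · intro x y h
    refine history_orbit_congr (fun s hs => h s (hs.2 n)) (sched_congr_of_agree
      (fun k hk c hc => h _ (by simp)) fun k hk => h _ (by simpa using hk.ne)) z
  · exact Integrable.of_bound (C := 1) (hvm.mul hm2).aestronglyMeasurable (.of_forall hHb)
  · intro x y h
    exact Finset.prod_congr rfl fun c hc => by rw [h (.service c) ⟨c, hc, rfl⟩]
  · intro x y h
    have hv : x (.vacation n) = y (.vacation n) := h _ (by simp)
    dsimp only
    rw [hv]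
    congr 1
    refine history_orbit_congr (fun s hs => h s ?_) (sched_congr_of_agree
      (fun k hk c hc => h _ ?_) fun k hk => h _ (by simp)) z
    · rintro ⟨c, _, rfl⟩
      exact hs.1 c rfl
    · rintro ⟨c', hc', he⟩
      cases he
      exact Finset.disjoint_left.1 (hdisj k hk) hc hc'
  · refine Integrable.of_bound (C := 1) (Measurable.mul (by fun_prop)
      (hvm.mul hm2)).aestronglyMeasurable (.of_forall fun x => norm_mul_le_one ?_ (hHb x))
    rw [norm_prod]
    exact Finset.prod_le_one (fun _ _ => norm_nonneg _) fun _ _ => norm_durationWeight_le hlam hz _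

/-- Carries the two fixed-schedule results, for retrials and for arrivals during the glue period,
over to the random schedule by freezing the durations. -/
lemma integral_history_glue (hlam : 0 < lam) (hν : 0 < ν) (hG : 0 < G)
    (hB : ∀ᵐ v ∂B, 0 ≤ v) (hS : ∀ᵐ v ∂S, 0 ≤ v) {z w u : ℂ} (hz : ‖z‖ ≤ 1) (hw : ‖w‖ ≤ 1)
    (hu1 : ‖u‖ ≤ 1) (hu : u = (1 - Real.exp (-(ν * G))) * w + Real.exp (-(ν * G)) * z) :
    ∫ x, ind (History G (sched G q x) q n x) *
        (z ^ (orbit G (sched G q x) (n + 1) (sched G q x n + G) x).ncard *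
          w ^ (gluedAt G (sched G q x) n x).ncard) ∂jointLaw lam ν N B S
      = ∫ x, Complex.exp (-(lam * G * (1 - w))) * (ind (History G (sched G q x) q n x) *
          u ^ (orbit G (sched G q x) n (sched G q x n) x).ncard) ∂jointLaw lam ν N B S := by
  have hH := measurable_ind (measurableSet_history (G := G)
    (fun k => measurable_sched (G := G) (q := q) k) measurable_id q n)
  refine integral_congr_mix dynamicSources ?_ ?_ ?_
  · refine Integrable.of_bound (C := 1) (hH.mul ((measurable_pow_ncard_orbit
      (fun k => measurable_sched k) measurable_id (n + 1) ((measurable_sched n).add_const G) z).mul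
        (measurable_pow_ncard_gluedAt (fun k => measurable_sched k) measurable_id n
          w))).aestronglyMeasurable (.of_forall fun x => ?_)
    exact norm_mul_le_one (norm_ind_le _)
      (norm_mul_le_one (norm_pow_le_one hz _) (norm_pow_le_one hw _))
  · exact (Integrable.of_bound (C := 1) (measurable_history_orbit _ _
      (measurable_sched n) u).aestronglyMeasurable
      (.of_forall fun x => norm_history_orbit_le _ _ _ _ hu1 x)).const_mul _
  · filter_upwards [ae_good (N := N) hlam hν hB hS] with x hx
    simp only [sched_mix, history_congr_of_agree (mix_dynamic_agree x _),
      orbit_congr_of_agree (mix_dynamic_agree x _), gluedAt_congr_of_agree (mix_dynamic_agree x _)]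
    have hgk : ∀ k < n, sched G q x k + G ≤ sched G q x n := fun k hk => sched_add_le hG hx hk
    have hg0 := sched_nonneg (q := q) hG hx n
    rw [integral_history_orbit_glued hlam hν hG hB hS hgk hg0 hz hw hu1 hu]
    simp only [← mul_assoc]
    simp only [mul_assoc (Complex.exp _)]
    rw [integral_const_mul, integral_history_orbit_mul_arrivals hlam hν hg0 hgk q hG.le hu1 hw]

end Recursion


/-! ### The countable partition by histories. -/

section Partition

variable {G : ℝ} {n : ℕ}

/-- Extension of a finite history by empty sets. -/
def extend (q : Fin n → Finset Customer) (k : ℕ) : Finset Customer :=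
  if h : k < n then q ⟨k, h⟩ else ∅

variable (G) in
/-- The event that the history of the first `n` glue periods is `q`. -/
def historyEvent (q : Fin n → Finset Customer) : Set (Source → ℝ) :=
  {x | History G (sched G (extend q) x) (extend q) n x}

lemma measurableSet_historyEvent (q : Fin n → Finset Customer) :
    MeasurableSet (historyEvent G q) :=
  measurableSet_history (fun k => measurable_sched k) measurable_id _ n

lemma mem_historyEvent_iff {q : Fin n → Finset Customer} {x : Source → ℝ} :
    x ∈ historyEvent G q ↔ ∀ k : Fin n, gluedAt G (glueStart G x) k x = q k := by
  refine history_sched_iff.trans ⟨fun h k => ?_, fun h k hk => ?_⟩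
  · rw [h k k.2, extend, dif_pos k.2]
  · rw [h ⟨k, hk⟩, extend, dif_pos hk]

lemma pairwise_disjoint_historyEvent :
    Pairwise (Function.onFun Disjoint fun q : Fin n → Finset Customer => historyEvent G q) := by
  intro q q' hne
  refine Set.disjoint_left.2 fun x hx hx' => hne (funext fun k => ?_)
  rw [mem_historyEvent_iff] at hx hx'
  exact Finset.coe_injective ((hx k).symm.trans (hx' k))

lemma Good.exists_mem_historyEvent {x : Source → ℝ} (hx : Good x) :
    ∃ q : Fin n → Finset Customer, x ∈ historyEvent G q :=
  ⟨fun k => (finite_gluedAt (G := G) (g := glueStart G x) hx k).toFinset,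
    mem_historyEvent_iff.2 fun k => by simp⟩

end Partition

/-! ### The recursion for the generating functions. -/

section Recursion

variable {lam ν G : ℝ} {N B S : Measure ℝ} [∀ s, IsProbabilityMeasure (sourceLaw lam ν N B S s)]

/-- On each history event `canon.X` agrees with a measurable function of the explicit schedule, and
countably many such events cover almost everything. -/
lemma aemeasurable_X_canon (hlam : 0 < lam) (hν : 0 < ν)
    (hB : ∀ᵐ v ∂B, 0 ≤ v) (hS : ∀ᵐ v ∂S, 0 ≤ v) (n : ℕ) :
    AEMeasurable (canon.X G n) (jointLaw lam ν N B S) := by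
  have hcov : ∀ᵐ x ∂jointLaw lam ν N B S,
      x ∈ ⋃ q : Fin n → Finset Customer, historyEvent G q :=
    (ae_good hlam hν hB hS).mono fun x hx => Set.mem_iUnion.2 hx.exists_mem_historyEvent
  rw [← Measure.restrict_eq_self_of_ae_mem hcov, aemeasurable_iUnion_iff]
  intro q
  have hm : Measurable fun x => (orbit G (sched G (extend q) x) n (sched G (extend q) x n) x).ncard :=
    measurable_ncard fun c => measurableSet_mem_orbit (fun k => measurable_sched k) measurable_id n
      (measurable_sched n) c
  refine ⟨_, hm, ?_⟩
  filter_upwards [ae_restrict_mem (measurableSet_historyEvent q)] with x hx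
  exact X_canon_of_history hx

lemma integrable_pow_X (hlam : 0 < lam) (hν : 0 < ν)
    (hB : ∀ᵐ v ∂B, 0 ≤ v) (hS : ∀ᵐ v ∂S, 0 ≤ v) {z : ℂ} (hz : ‖z‖ ≤ 1) (n : ℕ) :
    Integrable (fun x => z ^ canon.X G n x) (jointLaw lam ν N B S) :=
  Integrable.of_bound (C := 1) ((measurable_from_nat (f := fun k => z ^ k)).comp_aemeasurable
    (aemeasurable_X_canon hlam hν hB hS n)).aestronglyMeasurable
    (.of_forall fun _ => norm_pow_le_one hz _)

lemma setIntegral_eq_integral_ind_mul {X : Type*} [MeasurableSpace X] {P : Measure X}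
    {p : X → Prop} (hp : MeasurableSet {x | p x}) (F : X → ℂ) :
    ∫ x in {x | p x}, F x ∂P = ∫ x, ind (p x) * F x ∂P := by
  rw [← integral_indicator hp]
  refine integral_congr_ae (.of_forall fun x => ?_)
  dsimp only
  by_cases h : p x
  · rw [Set.indicator_of_mem (show x ∈ {x | p x} from h), ind_of h, one_mul]
  · rw [Set.indicator_of_notMem (show x ∉ {x | p x} from h), ind_of_not h, zero_mul]

/-- Cutting further by the set `F` glued in period `n` makes the number of services deterministic.
Each contributes `β(z)`, and summing over `F` restores the random exponent. -/
lemma integral_history_next (hlam : 0 < lam) (hν : 0 < ν) (hG : 0 < G)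
    (hB : ∀ᵐ v ∂B, 0 ≤ v) (hS : ∀ᵐ v ∂S, 0 ≤ v) {z : ℂ} (hz : ‖z‖ ≤ 1)
    (hβ : ‖arrivalsPGF lam B z‖ ≤ 1) (q : ℕ → Finset Customer) (n : ℕ) :
    ∫ x, ind (History G (sched G q x) q n x) * z ^ canon.X G (n + 1) x ∂jointLaw lam ν N B S
      = ∫ x, arrivalsPGF lam S z * (ind (History G (sched G q x) q n x) *
        (z ^ (orbit G (sched G q x) (n + 1) (sched G q x n + G) x).ncard *
          arrivalsPGF lam B z ^ (gluedAt G (sched G q x) n x).ncard)) ∂jointLaw lam ν N B S := by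
  classical
  have hHset := measurableSet_history (G := G)
    (fun k => measurable_sched (G := G) (q := q) k) measurable_id q n
  have hH := measurable_ind hHset
  have hglue : ∀ F : Finset Customer, MeasurableSet {x | gluedAt G (sched G q x) n x = F} :=
    fun F => measurableSet_gluedAt_eq (fun k => measurable_sched k) measurable_id n F
  refine integral_eq_of_countable_partition hglue ?_ ?_ ?_ ?_ fun F => ?_
  · intro F F' hne
    exact Set.disjoint_left.2 fun x hx hx' => hne (Finset.coe_injective (hx.symm.trans hx'))
  · filter_upwards [ae_good hlam hν hB hS] with x hx
    exact ⟨(finite_gluedAt (G := G) (g := sched G q x) hx n).toFinset, by simp⟩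
  · exact (integrable_pow_X hlam hν hB hS hz (n + 1)).bdd_mul (c := 1) hH.aestronglyMeasurable
      (.of_forall fun x => norm_ind_le _)
  · refine (Integrable.of_bound (C := 1) (hH.mul ((measurable_pow_ncard_orbit
      (fun k => measurable_sched k) measurable_id (n + 1) ((measurable_sched n).add_const G) z).mul
        (measurable_pow_ncard_gluedAt (fun k => measurable_sched k) measurable_id n
          _))).aestronglyMeasurable (.of_forall fun x => ?_)).const_mul _
    exact norm_mul_le_one (norm_ind_le _)
      (norm_mul_le_one (norm_pow_le_one hz _) (norm_pow_le_one hβ _))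
  · rw [setIntegral_eq_integral_ind_mul (hglue F), setIntegral_eq_integral_ind_mul (hglue F)]
    -- `q'` is the history prolonged by `F`; it agrees with `q` below `n`, so the starting times up
    -- to period `n` are unchanged.
    set q' := Function.update q n F with hq'
    have hqn : q' n = F := Function.update_self ..
    have hqk : ∀ k < n, q k = q' k := fun k hk => (Function.update_of_ne hk.ne _ _).symm
    have hsch : ∀ x, ∀ k ≤ n, sched G q x k = sched G q' x k := fun x => sched_congr_history hqk
    have hhist : ∀ x, (gluedAt G (sched G q x) n x = F ∧ History G (sched G q x) q n x) ↔
        History G (sched G q' x) q' (n + 1) x := by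
      intro x
      have h1 : gluedAt G (sched G q x) n x = gluedAt G (sched G q' x) n x :=
        gluedAt_congr (hsch x) x
      have h2 : History G (sched G q x) q n x ↔ History G (sched G q' x) q n x :=
        history_congr (fun k hk => hsch x k hk.le) q x
      rw [h1, h2]
      constructor
      · rintro ⟨h3, h4⟩ k hk
        rcases Nat.lt_succ_iff_lt_or_eq.1 hk with hk | rfl
        · rw [h4 k hk, hqk k hk]
        · rw [h3, hqn]
      · intro h
        refine ⟨by rw [h n (Nat.lt_succ_self n), hqn], fun k hk => ?_⟩
        rw [h k (by omega), hqk k hk]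
    have hl : ∀ x, ind (gluedAt G (sched G q x) n x = F) *
        (ind (History G (sched G q x) q n x) * z ^ canon.X G (n + 1) x)
        = ind (History G (sched G q' x) q' (n + 1) x) *
          z ^ (orbit G (sched G q' x) (n + 1) (sched G q' x (n + 1)) x).ncard := by
      intro x
      rw [← mul_assoc, ← ind_and, hhist]
      by_cases h : History G (sched G q' x) q' (n + 1) x
      · rw [X_canon_of_history h]
      · rw [ind_of_not h, zero_mul, zero_mul]
    have hr : ∀ x, ind (gluedAt G (sched G q x) n x = F) *
        (arrivalsPGF lam S z * (ind (History G (sched G q x) q n x) *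
        (z ^ (orbit G (sched G q x) (n + 1) (sched G q x n + G) x).ncard *
          arrivalsPGF lam B z ^ (gluedAt G (sched G q x) n x).ncard)))
        = arrivalsPGF lam B z ^ (q' n).card * (arrivalsPGF lam S z *
          (ind (History G (sched G q' x) q' (n + 1) x) *
          z ^ (orbit G (sched G q' x) (n + 1) (sched G q' x n + G) x).ncard)) := by
      intro x
      rw [← hhist, ind_and, hqn]
      by_cases h : gluedAt G (sched G q x) n x = F
      · rw [ind_of h, h, Set.ncard_coe_finset, ← hsch x n le_rfl,
          orbit_congr (g := sched G q x) (fun k hk => hsch x k (Nat.lt_succ_iff.1 hk))]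
        ring
      · rw [ind_of_not h]; ring
    simp only [hl, hr]
    rw [integral_history_orbit_next hlam hν hG hB hS hz, integral_durations_mul_history hlam hB hS hz,
      integral_const_mul, integral_const_mul]

/-- The recursion for the generating functions of the numbers of customers at the start of the
glue periods. -/
lemma integral_pow_X_succ (hlam : 0 < lam) (hν : 0 < ν) (hG : 0 < G)
    (hB : ∀ᵐ v ∂B, 0 ≤ v) (hS : ∀ᵐ v ∂S, 0 ≤ v) {z : ℂ} (hz : ‖z‖ ≤ 1)
    (hβ : ‖arrivalsPGF lam B z‖ ≤ 1) (hf : ‖f lam ν G B z‖ ≤ 1) (n : ℕ) :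
    ∫ x, z ^ canon.X G (n + 1) x ∂jointLaw lam ν N B S
      = K lam G B S z * ∫ x, f lam ν G B z ^ canon.X G n x ∂jointLaw lam ν N B S := by
  rw [← integral_const_mul]
  refine integral_eq_of_countable_partition (fun q : Fin n → Finset Customer =>
    measurableSet_historyEvent (G := G) q) pairwise_disjoint_historyEvent ?_
    (integrable_pow_X hlam hν hB hS hz (n + 1)) ((integrable_pow_X hlam hν hB hS hf n).const_mul _)
    fun q => ?_
  · exact (ae_good hlam hν hB hS).mono fun x hx => hx.exists_mem_historyEvent
  · have hm := measurableSet_historyEvent (G := G) q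
    have hX : ∫ x in historyEvent G q, K lam G B S z * f lam ν G B z ^ canon.X G n x
          ∂jointLaw lam ν N B S
        = K lam G B S z * ∫ x, ind (History G (sched G (extend q) x) (extend q) n x) *
          f lam ν G B z ^ (orbit G (sched G (extend q) x) n (sched G (extend q) x n) x).ncard
          ∂jointLaw lam ν N B S := by
      rw [integral_const_mul, ← setIntegral_eq_integral_ind_mul hm]
      congr 1
      refine setIntegral_congr_fun hm fun x hx => ?_
      rw [X_canon_of_history hx]
    have hK : K lam G B S z
        = arrivalsPGF lam S z * Complex.exp (-(lam * G * (1 - arrivalsPGF lam B z))) := by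
      rw [K]; congr 2; ring
    -- The glue period is evaluated with `w = β(z)`, for which the weight `u` is `f(z)`.
    rw [hX, historyEvent, setIntegral_eq_integral_ind_mul hm,
      integral_history_next hlam hν hG hB hS hz hβ, integral_const_mul,
      integral_history_glue hlam hν hG hB hS hz hβ hf (by simp [f]), integral_const_mul, hK]
    ring

end Recursion


/-! ### Bounds for `β`, `f` and `K` on the closed unit disc. -/

section Analysis

/-- The exponential is 1-Lipschitz on the left half-plane, which is convex and on which its
derivative is bounded by `1`. -/
lemma norm_one_sub_exp_neg_le {w : ℂ} (hw : 0 ≤ w.re) : ‖1 - Complex.exp (-w)‖ ≤ ‖w‖ := by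
  have h := Convex.norm_image_sub_le_of_norm_hasDerivWithin_le (𝕜 := ℂ) (f := Complex.exp)
    (f' := Complex.exp) (s := {a | a.re ≤ 0}) (x := -w) (y := 0) (C := 1)
    (fun a _ => (Complex.hasDerivAt_exp a).hasDerivWithinAt)
    (fun a ha => by rw [Complex.norm_exp, Real.exp_le_one_iff]; exact ha)
    (convex_halfSpace_re_le 0) (by simpa using hw) (by simp)
  simpa using h

lemma norm_exp_neg_le_one {w : ℂ} (hw : 0 ≤ w.re) : ‖Complex.exp (-w)‖ ≤ 1 := by
  rw [Complex.norm_exp, Real.exp_le_one_iff]; simpa using hw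

lemma re_one_sub_nonneg {z : ℂ} (hz : ‖z‖ ≤ 1) : 0 ≤ (1 - z).re := by
  simpa using (Complex.re_le_norm z).trans hz

variable {lam ν G : ℝ} {B S : Measure ℝ} [IsProbabilityMeasure B] [IsProbabilityMeasure S] {z : ℂ}

lemma re_mul_one_sub_nonneg (hlam : 0 < lam) (hz : ‖z‖ ≤ 1) {x : ℝ} (hx : 0 ≤ x) :
    0 ≤ (lam * (1 - z) * x : ℂ).re := by
  have h := re_one_sub_nonneg hz
  rw [Complex.re_mul_ofReal, Complex.re_ofReal_mul]
  positivity

lemma norm_arrivalsPGF_le (hlam : 0 < lam) (hB : ∀ᵐ x ∂B, 0 ≤ x) (hz : ‖z‖ ≤ 1) :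
    ‖arrivalsPGF lam B z‖ ≤ 1 := by
  have h := norm_integral_le_of_norm_le_const (μ := B) (C := 1)
    (f := fun x : ℝ => Complex.exp (-(lam * (1 - z) * x)))
    (hB.mono fun x hx => norm_exp_neg_le_one (re_mul_one_sub_nonneg hlam hz hx))
  simpa [arrivalsPGF, lst] using h

lemma norm_one_sub_arrivalsPGF_le (hlam : 0 < lam) (hB : ∀ᵐ x ∂B, 0 ≤ x)
    (hBint : Integrable (fun x : ℝ => x) B) (hz : ‖z‖ ≤ 1) :
    ‖1 - arrivalsPGF lam B z‖ ≤ lam * (∫ x, x ∂B) * ‖1 - z‖ := by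
  have hint : Integrable (fun x : ℝ => Complex.exp (-(lam * (1 - z) * x))) B :=
    Integrable.of_bound (C := 1) (Measurable.aestronglyMeasurable (by fun_prop))
      (hB.mono fun x hx => norm_exp_neg_le_one (re_mul_one_sub_nonneg hlam hz hx))
  have h1 : 1 - arrivalsPGF lam B z
      = ∫ x : ℝ, (1 - Complex.exp (-(lam * (1 - z) * x))) ∂B := by
    rw [integral_sub (integrable_const 1) hint]
    simp [arrivalsPGF, lst]
  rw [h1]
  calc _ ≤ ∫ x : ℝ, lam * ‖1 - z‖ * x ∂B := by
        refine norm_integral_le_of_norm_le (hBint.const_mul _) (hB.mono fun x hx => ?_)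
        refine (norm_one_sub_exp_neg_le (re_mul_one_sub_nonneg hlam hz hx)).trans_eq ?_
        rw [norm_mul, norm_mul, Complex.norm_real, Complex.norm_real, Real.norm_of_nonneg hlam.le,
          Real.norm_of_nonneg hx]
    _ = _ := by rw [integral_const_mul]; ring

lemma norm_f_le (hν : 0 < ν) (hG : 0 < G) (hlam : 0 < lam) (hB : ∀ᵐ x ∂B, 0 ≤ x)
    (hz : ‖z‖ ≤ 1) : ‖f lam ν G B z‖ ≤ 1 := by
  have hp : Real.exp (-(ν * G)) ≤ 1 := Real.exp_le_one_iff.2 (by nlinarith)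
  have hp0 := Real.exp_pos (-(ν * G))
  have hβ := norm_arrivalsPGF_le hlam hB hz
  have : f lam ν G B z = (1 - Real.exp (-(ν * G)) : ℝ) * arrivalsPGF lam B z
      + (Real.exp (-(ν * G)) : ℝ) * z := by simp [f]
  rw [this]
  refine (norm_add_le _ _).trans ?_
  rw [norm_mul, norm_mul, Complex.norm_real, Complex.norm_real, Real.norm_of_nonneg hp0.le,
    Real.norm_of_nonneg (by linarith)]
  nlinarith

lemma norm_one_sub_f_le (hν : 0 < ν) (hG : 0 < G) (hlam : 0 < lam) (hB : ∀ᵐ x ∂B, 0 ≤ x)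
    (hBint : Integrable (fun x : ℝ => x) B) (hz : ‖z‖ ≤ 1) :
    ‖1 - f lam ν G B z‖ ≤ ((1 - Real.exp (-(ν * G))) * (lam * ∫ x, x ∂B) + Real.exp (-(ν * G))) *
      ‖1 - z‖ := by
  have hp : Real.exp (-(ν * G)) ≤ 1 := Real.exp_le_one_iff.2 (by nlinarith)
  have hp0 := Real.exp_pos (-(ν * G))
  have hβ := norm_one_sub_arrivalsPGF_le hlam hB hBint hz
  have : 1 - f lam ν G B z = (1 - Real.exp (-(ν * G)) : ℝ) * (1 - arrivalsPGF lam B z)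
      + (Real.exp (-(ν * G)) : ℝ) * (1 - z) := by simp [f]; ring
  rw [this]
  refine (norm_add_le _ _).trans ?_
  rw [norm_mul, norm_mul, Complex.norm_real, Complex.norm_real, Real.norm_of_nonneg hp0.le,
    Real.norm_of_nonneg (by linarith)]
  have := mul_le_mul_of_nonneg_left hβ (by linarith : 0 ≤ 1 - Real.exp (-(ν * G)))
  linarith

lemma norm_one_sub_K_le (hG : 0 < G) (hlam : 0 < lam) (hB : ∀ᵐ x ∂B, 0 ≤ x)
    (hS : ∀ᵐ x ∂S, 0 ≤ x) (hBint : Integrable (fun x : ℝ => x) B)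
    (hSint : Integrable (fun x : ℝ => x) S) (hz : ‖z‖ ≤ 1) :
    ‖1 - K lam G B S z‖ ≤ (lam * (∫ x, x ∂S) + lam * (lam * ∫ x, x ∂B) * G) * ‖1 - z‖ := by
  have hβ := norm_one_sub_arrivalsPGF_le hlam hB hBint hz
  have hσ := norm_one_sub_arrivalsPGF_le hlam hS hSint hz
  have hσ1 := norm_arrivalsPGF_le hlam hS hz
  set w : ℂ := lam * (1 - arrivalsPGF lam B z) * G with hw
  have hwre : 0 ≤ w.re := by
    have := re_one_sub_nonneg (norm_arrivalsPGF_le hlam hB hz)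
    rw [hw, Complex.re_mul_ofReal, Complex.re_ofReal_mul]
    positivity
  have hwn : ‖w‖ ≤ lam * (lam * (∫ x, x ∂B) * ‖1 - z‖) * G := by
    rw [hw, norm_mul, norm_mul, Complex.norm_real, Complex.norm_real, Real.norm_of_nonneg hlam.le,
      Real.norm_of_nonneg hG.le]
    gcongr
  have h1 : 1 - K lam G B S z = (1 - arrivalsPGF lam S z)
      + arrivalsPGF lam S z * (1 - Complex.exp (-w)) := by rw [K]; ring
  rw [h1]
  refine (norm_add_le _ _).trans ?_
  rw [norm_mul]
  have h2 := (norm_one_sub_exp_neg_le hwre).trans hwn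
  have h3 : ‖arrivalsPGF lam S z‖ * ‖1 - Complex.exp (-w)‖ ≤ 1 * _ :=
    mul_le_mul hσ1 h2 (norm_nonneg _) zero_le_one
  linarith

end Analysis

/-! ### Infinite products along the orbit of a contraction towards `1`. -/

section Contraction

variable {F κ : ℂ → ℂ} {c M : ℝ}

lemma norm_iterate_le (hF : ∀ z, ‖z‖ ≤ 1 → ‖F z‖ ≤ 1) {z : ℂ} (hz : ‖z‖ ≤ 1) (j : ℕ) :
    ‖F^[j] z‖ ≤ 1 := by
  induction j with
  | zero => exact hz
  | succ j ih => rw [Function.iterate_succ_apply']; exact hF _ ih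

lemma norm_one_sub_iterate_le (hF : ∀ z, ‖z‖ ≤ 1 → ‖F z‖ ≤ 1) (hc0 : 0 ≤ c)
    (hc : ∀ z, ‖z‖ ≤ 1 → ‖1 - F z‖ ≤ c * ‖1 - z‖) {z : ℂ} (hz : ‖z‖ ≤ 1) (j : ℕ) :
    ‖1 - F^[j] z‖ ≤ c ^ j * ‖1 - z‖ := by
  induction j with
  | zero => simp
  | succ j ih =>
    rw [Function.iterate_succ_apply', pow_succ', mul_assoc]
    exact (hc _ (norm_iterate_le hF hz j)).trans (mul_le_mul_of_nonneg_left ih hc0)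

lemma norm_one_sub_comp_iterate_le (hF : ∀ z, ‖z‖ ≤ 1 → ‖F z‖ ≤ 1) (hc0 : 0 ≤ c)
    (hc : ∀ z, ‖z‖ ≤ 1 → ‖1 - F z‖ ≤ c * ‖1 - z‖) (hM0 : 0 ≤ M)
    (hM : ∀ z, ‖z‖ ≤ 1 → ‖1 - κ z‖ ≤ M * ‖1 - z‖) {z : ℂ} (hz : ‖z‖ ≤ 1) (j : ℕ) :
    ‖κ (F^[j] z) - 1‖ ≤ M * ‖1 - z‖ * c ^ j := by
  rw [norm_sub_rev]
  refine (hM _ (norm_iterate_le hF hz j)).trans ?_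
  have := mul_le_mul_of_nonneg_left (norm_one_sub_iterate_le hF hc0 hc hz j) hM0
  linarith

lemma hasProd_comp_iterate (hF : ∀ z, ‖z‖ ≤ 1 → ‖F z‖ ≤ 1) (hc0 : 0 ≤ c) (hc1 : c < 1)
    (hc : ∀ z, ‖z‖ ≤ 1 → ‖1 - F z‖ ≤ c * ‖1 - z‖) (hM0 : 0 ≤ M)
    (hM : ∀ z, ‖z‖ ≤ 1 → ‖1 - κ z‖ ≤ M * ‖1 - z‖) {z : ℂ} (hz : ‖z‖ ≤ 1) :
    HasProd (fun j => κ (F^[j] z)) (∏' j, κ (F^[j] z)) := by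
  have hs : Summable fun j => ‖κ (F^[j] z) - 1‖ :=
    Summable.of_nonneg_of_le (fun _ => norm_nonneg _)
      (norm_one_sub_comp_iterate_le hF hc0 hc hM0 hM hz)
      ((summable_geometric_of_lt_one hc0 hc1).mul_left _)
  have := multipliable_one_add_of_summable hs
  simp only [add_sub_cancel] at this
  exact this.hasProd

/-- The bound tends to `0` as `z` tends to `1`: this is the continuity that the continuity theorem
requires. -/
lemma norm_tprod_comp_iterate_sub_one_le (hF : ∀ z, ‖z‖ ≤ 1 → ‖F z‖ ≤ 1) (hc0 : 0 ≤ c)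
    (hc1 : c < 1) (hc : ∀ z, ‖z‖ ≤ 1 → ‖1 - F z‖ ≤ c * ‖1 - z‖) (hM0 : 0 ≤ M)
    (hM : ∀ z, ‖z‖ ≤ 1 → ‖1 - κ z‖ ≤ M * ‖1 - z‖) {z : ℂ} (hz : ‖z‖ ≤ 1) :
    ‖∏' j, κ (F^[j] z) - 1‖ ≤ Real.exp (M * ‖1 - z‖ * (1 - c)⁻¹) - 1 := by
  refine le_of_tendsto (((hasProd_comp_iterate hF hc0 hc1 hc hM0 hM hz).tendsto_prod_nat.sub_const
    1).norm) (.of_forall fun n => ?_)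
  have h := Finset.norm_prod_one_add_sub_one_le (Finset.range n) fun j => κ (F^[j] z) - 1
  simp only [add_sub_cancel] at h
  refine h.trans (sub_le_sub_right (Real.exp_le_exp.2 ?_) 1)
  calc _ ≤ ∑ j ∈ Finset.range n, M * ‖1 - z‖ * c ^ j :=
        Finset.sum_le_sum fun j _ => norm_one_sub_comp_iterate_le hF hc0 hc hM0 hM hz j
    _ ≤ ∑' j, M * ‖1 - z‖ * c ^ j :=
        ((summable_geometric_of_lt_one hc0 hc1).mul_left _).sum_le_tsum _
          fun _ _ => by positivity
    _ = _ := by rw [tsum_mul_left, tsum_geometric_of_lt_one hc0 hc1]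

end Contraction

/-! ### Continuity theorem for generating functions on `ℕ`. -/

section Convergence

lemma charFun_map_natCast (μ : Measure ℕ) (t : ℝ) :
    charFun (μ.map ((↑) : ℕ → ℝ)) t = ∫ k, Complex.exp (t * Complex.I) ^ k ∂μ := by
  rw [charFun_apply_real, integral_map (by fun_prop) (by fun_prop)]
  congr 1
  ext k
  rw [← Complex.exp_nat_mul]
  congr 1
  push_cast
  ring

lemma norm_exp_ofReal_mul_I_le (t : ℝ) : ‖Complex.exp (t * Complex.I)‖ ≤ 1 :=
  (Complex.norm_exp_ofReal_mul_I t).le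

lemma measure_nat_ext_of_pgf {μ ν : Measure ℕ} [IsProbabilityMeasure μ] [IsProbabilityMeasure ν]
    (h : ∀ z : ℂ, ‖z‖ ≤ 1 → ∫ k, z ^ k ∂μ = ∫ k, z ^ k ∂ν) : μ = ν := by
  have hme : MeasurableEmbedding ((↑) : ℕ → ℝ) :=
    Nat.isClosedEmbedding_coe_real.measurableEmbedding
  have := Measure.isProbabilityMeasure_map (μ := μ) (f := ((↑) : ℕ → ℝ)) (by fun_prop)
  have := Measure.isProbabilityMeasure_map (μ := ν) (f := ((↑) : ℕ → ℝ)) (by fun_prop)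
  rw [← hme.comap_map μ, ← hme.comap_map ν]
  congr 1
  refine Measure.ext_of_charFun (funext fun t => ?_)
  rw [charFun_map_natCast, charFun_map_natCast, h _ (norm_exp_ofReal_mul_I_le t)]

/-- Since `ℕ` is closed in `ℝ`, compact sets pull back to compact sets. -/
lemma isTightMeasureSet_of_map_natCast {s : Set (Measure ℕ)}
    (h : IsTightMeasureSet ((fun μ => μ.map ((↑) : ℕ → ℝ)) '' s)) : IsTightMeasureSet s := by
  rw [isTightMeasureSet_iff_exists_isCompact_measure_compl_le] at h ⊢
  intro ε hε
  obtain ⟨C, hC, hCs⟩ := h ε hε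
  refine ⟨_, Nat.isClosedEmbedding_coe_real.isCompact_preimage hC, fun μ hμ => ?_⟩
  have := hCs _ ⟨μ, hμ, rfl⟩
  rwa [Measure.map_apply (by fun_prop) hC.measurableSet.compl] at this

/-- Continuity theorem for generating functions: if those of probability measures on `ℕ` converge
on the closed unit disc to a function that is continuous at `1` along the unit circle, then the
measures converge weakly. -/
lemma exists_tendsto_of_tendsto_pgf {μ : ℕ → ProbabilityMeasure ℕ} {φ : ℂ → ℂ}
    (hφ : ContinuousAt (fun t : ℝ => φ (Complex.exp (t * Complex.I))) 0)
    (h : ∀ z : ℂ, ‖z‖ ≤ 1 →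
      Tendsto (fun n => ∫ k, z ^ k ∂(μ n : Measure ℕ)) atTop (nhds (φ z))) :
    ∃ π : ProbabilityMeasure ℕ, Tendsto μ atTop (nhds π) ∧
      ∀ z : ℂ, ‖z‖ ≤ 1 → ∫ k, z ^ k ∂(π : Measure ℕ) = φ z := by
  have htight : IsTightMeasureSet {x : Measure ℕ | ∃ m ∈ Set.range μ, (m : Measure ℕ) = x} := by
    refine isTightMeasureSet_of_map_natCast ?_
    have hp : ∀ n, IsProbabilityMeasure ((μ n : Measure ℕ).map ((↑) : ℕ → ℝ)) := fun n =>
      Measure.isProbabilityMeasure_map (by fun_prop)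
    have := isTightMeasureSet_of_tendsto_charFun
      (μ := fun n => (μ n : Measure ℕ).map ((↑) : ℕ → ℝ)) hφ fun t => by
        simp only [charFun_map_natCast]
        exact h _ (norm_exp_ofReal_mul_I_le t)
    refine this.subset ?_
    rintro _ ⟨_, ⟨_, ⟨n, rfl⟩, rfl⟩, rfl⟩
    exact ⟨n, rfl⟩
  have hcomp := isCompact_closure_of_isTightMeasureSet htight
  -- On the discrete space `ℕ` each `k ↦ z ^ k` is a bounded continuous test function, so all
  -- cluster points share the generating function `φ`. They therefore coincide, and compactness
  -- gives convergence.
  have hcluster : ∀ π : ProbabilityMeasure ℕ, MapClusterPt π atTop μ →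
      ∀ z : ℂ, ‖z‖ ≤ 1 → ∫ k, z ^ k ∂(π : Measure ℕ) = φ z := by
    intro π hπ z hz
    obtain ⟨U, hU, hUπ⟩ := mapClusterPt_iff_ultrafilter.1 hπ
    have h1 := (ProbabilityMeasure.tendsto_iff_forall_integral_rclike_tendsto ℂ).1 hUπ
      (BoundedContinuousFunction.ofNormedAddCommGroupDiscrete (fun k : ℕ => z ^ k) 1
        fun k => norm_pow_le_one hz k)
    exact tendsto_nhds_unique h1 ((h z hz).mono_left hU)
  obtain ⟨π, -, hπ⟩ := hcomp.exists_mapClusterPt (f := atTop) (u := μ)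
    (le_principal_iff.2 (mem_map.2 (univ_mem' fun n => subset_closure ⟨n, rfl⟩)))
  refine ⟨π, hcomp.tendsto_nhds_of_unique_mapClusterPt
    (.of_forall fun n => subset_closure ⟨n, rfl⟩) fun π' _ hπ' => ?_, hcluster π hπ⟩
  have hp : IsProbabilityMeasure (π' : Measure ℕ) := π'.2
  have hp' : IsProbabilityMeasure (π : Measure ℕ) := π.2
  refine Subtype.ext (measure_nat_ext_of_pgf (μ := (π' : Measure ℕ)) (ν := (π : Measure ℕ))
    fun z hz => ?_)
  exact (hcluster π' hπ' z hz).trans (hcluster π hπ z hz).symm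

end Convergence

/-! ### Transfer from the given model to the canonical one. -/

section Model

variable {Ω : Type*} [MeasurableSpace Ω] {P : Measure Ω} {lam ν G : ℝ} {B S : Measure ℝ}
  {I : Input Ω}

lemma Input.IsModel.hasLaw_driver (hI : I.IsModel lam ν B S P) :
    HasLaw (fun ω s => I.driver s ω)
      (jointLaw lam ν (P.map fun ω => (I.initial ω : ℝ)) B S) P := by
  have hinit : AEMeasurable (fun ω => (I.initial ω : ℝ)) P :=
    measurable_from_nat.comp_aemeasurable hI.aemeasurable_initial
  have hlaw : ∀ s, HasLaw (I.driver s)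
      (sourceLaw lam ν (P.map fun ω => (I.initial ω : ℝ)) B S s) P := by
    intro s
    cases s with
    | initial => exact ⟨hinit, rfl⟩
    | interarrival j => exact hI.law_interarrival j
    | retrial c m => exact hI.law_retrial c m
    | service c => exact hI.law_service c
    | vacation n => exact hI.law_vacation n
  exact hI.indep.hasLaw_infinitePi hlaw (aemeasurable_pi_iff.2 fun s => (hlaw s).aemeasurable)

end Model

end GlueQueue

theorem theorem1 {Ω : Type*} [MeasurableSpace Ω] (P : Measure Ω) [IsProbabilityMeasure P]
    (lam ν G : ℝ) (hlam : 0 < lam) (hν : 0 < ν) (hG : 0 < G)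
    (B S : Measure ℝ) [IsProbabilityMeasure B] [IsProbabilityMeasure S]
    (hB : ∀ᵐ x ∂B, 0 ≤ x) (hS : ∀ᵐ x ∂S, 0 ≤ x)
    (hBint : Integrable (fun x : ℝ => x) B) (hSint : Integrable (fun x : ℝ => x) S)
    (hρ : lam * (∫ x, x ∂B) < 1)
    (I : GlueQueue.Input Ω) (hI : I.IsModel lam ν B S P) :
    ∃ π : ProbabilityMeasure ℕ,
      TendstoInDistribution (fun n => I.X G n) atTop (id : ℕ → ℕ) (fun _ => P) (π : Measure ℕ) ∧
      ∀ z : ℂ, ‖z‖ ≤ 1 →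
        HasProd (fun j : ℕ => GlueQueue.K lam G B S ((GlueQueue.f lam ν G B)^[j] z))
          (∫ k : ℕ, z ^ k ∂(π : Measure ℕ)) := by
  open GlueQueue in
  have hdrv := hI.hasLaw_driver
  set N : Measure ℝ := P.map fun ω => (I.initial ω : ℝ) with hN
  have : IsProbabilityMeasure N := Measure.isProbabilityMeasure_map
    (measurable_from_nat.comp_aemeasurable hI.aemeasurable_initial)
  have hprob := isProbabilityMeasure_sourceLaw hlam hν (N := N) (B := B) (S := S)
  have hXc : ∀ n, I.X G n = canon.X G n ∘ fun ω s => I.driver s ω := fun n =>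
    funext fun ω => I.X_eq_canon G n ω
  have hXm : ∀ n, AEMeasurable (I.X G n) P := fun n => by
    rw [hXc]
    have h1 := aemeasurable_X_canon (N := N) (G := G) hlam hν hB hS n
    rw [← hdrv.map_eq] at h1
    exact h1.comp_aemeasurable hdrv.aemeasurable
  have hpgf : ∀ n, ∀ z : ℂ, ‖z‖ ≤ 1 →
      ∫ ω, z ^ I.X G n ω ∂P = ∫ x, z ^ canon.X G n x ∂jointLaw lam ν N B S := fun n z hz => by
    rw [← hdrv.integral_comp (integrable_pow_X hlam hν hB hS hz n).aestronglyMeasurable, hXc]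
    rfl
  have hβ : ∀ z : ℂ, ‖z‖ ≤ 1 → ‖arrivalsPGF lam B z‖ ≤ 1 := fun z hz =>
    norm_arrivalsPGF_le hlam hB hz
  have hf : ∀ z : ℂ, ‖z‖ ≤ 1 → ‖f lam ν G B z‖ ≤ 1 := fun z hz => norm_f_le hν hG hlam hB hz
  have hEB : 0 ≤ ∫ x, x ∂B := integral_nonneg_of_ae hB
  have hES : 0 ≤ ∫ x, x ∂S := integral_nonneg_of_ae hS
  have hp1 : Real.exp (-(ν * G)) < 1 := by
    rw [← Real.exp_zero]; exact Real.exp_lt_exp.2 (by nlinarith)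
  have hp0 := Real.exp_pos (-(ν * G))
  -- The contraction constant is a convex combination of `ρ` and `1` in which `ρ` has positive
  -- weight, so `ρ < 1` gives `c < 1`.
  obtain ⟨c, hc⟩ : ∃ c, c = (1 - Real.exp (-(ν * G))) * (lam * ∫ x, x ∂B)
    + Real.exp (-(ν * G)) := ⟨_, rfl⟩
  obtain ⟨M, hM⟩ : ∃ M, M = lam * (∫ x, x ∂S) + lam * (lam * ∫ x, x ∂B) * G := ⟨_, rfl⟩
  have hc0 : 0 ≤ c := by
    rw [hc]
    have := mul_nonneg (sub_nonneg.2 hp1.le) (mul_nonneg hlam.le hEB)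
    linarith
  have hc1 : c < 1 := by rw [hc]; nlinarith
  have hM0 : 0 ≤ M := by rw [hM]; positivity
  have hcf : ∀ z, ‖z‖ ≤ 1 → ‖1 - f lam ν G B z‖ ≤ c * ‖1 - z‖ := fun z hz =>
    hc ▸ norm_one_sub_f_le hν hG hlam hB hBint hz
  have hMK : ∀ z, ‖z‖ ≤ 1 → ‖1 - K lam G B S z‖ ≤ M * ‖1 - z‖ := fun z hz =>
    hM ▸ norm_one_sub_K_le hG hlam hB hS hBint hSint hz
  have hiter : ∀ n, ∀ z : ℂ, ‖z‖ ≤ 1 → ∫ ω, z ^ I.X G n ω ∂P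
      = (∏ j ∈ Finset.range n, K lam G B S ((f lam ν G B)^[j] z)) *
        ∫ ω, ((f lam ν G B)^[n] z) ^ I.X G 0 ω ∂P := by
    intro n
    induction n with
    | zero => simp
    | succ n ih =>
      intro z hz
      rw [hpgf (n + 1) z hz, integral_pow_X_succ hlam hν hG hB hS hz (hβ z hz) (hf z hz),
        ← hpgf n _ (hf z hz), ih _ (hf z hz), Finset.prod_range_succ']
      simp only [Function.iterate_succ_apply, Function.iterate_zero, id]
      ring
  have hprod := fun z hz => hasProd_comp_iterate (F := f lam ν G B) (κ := K lam G B S) hf hc0 hc1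
    hcf hM0 hMK (z := z) hz
  have hlim : ∀ z : ℂ, ‖z‖ ≤ 1 → Tendsto (fun n => ∫ ω, z ^ I.X G n ω ∂P) atTop
      (nhds (∏' j, K lam G B S ((f lam ν G B)^[j] z))) := by
    intro z hz
    have hfz : Tendsto (fun n => (f lam ν G B)^[n] z) atTop (nhds 1) := by
      rw [tendsto_iff_norm_sub_tendsto_zero]
      refine squeeze_zero (fun _ => norm_nonneg _) (fun n => ?_)
        (by simpa using (tendsto_pow_atTop_nhds_zero_of_lt_one hc0 hc1).mul_const ‖1 - z‖)
      rw [norm_sub_rev]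
      exact norm_one_sub_iterate_le hf hc0 hcf hz n
    -- The initial number is forgotten: domination by `1` suffices, so no moment of its law is
    -- needed.
    have h1 : Tendsto (fun n => ∫ ω, ((f lam ν G B)^[n] z) ^ I.X G 0 ω ∂P) atTop
        (nhds (∫ _, (1 : ℂ) ∂P)) := by
      refine tendsto_integral_of_dominated_convergence (fun _ => 1) (fun n => ?_)
        (integrable_const 1) (fun n => ?_) (.of_forall fun ω => ?_)
      · exact ((measurable_from_nat (f := fun k => ((f lam ν G B)^[n] z) ^ k)).comp_aemeasurable
          (hXm 0)).aestronglyMeasurable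
      · exact .of_forall fun ω => norm_pow_le_one (norm_iterate_le hf hz n) _
      · simpa using hfz.pow (I.X G 0 ω)
    have h2 := (hprod z hz).tendsto_prod_nat.mul h1
    simp only [integral_const, probReal_univ, one_smul, mul_one] at h2
    exact h2.congr fun n => (hiter n z hz).symm
  have hcont : ContinuousAt (fun t : ℝ => (fun z => ∏' j, K lam G B S ((f lam ν G B)^[j] z))
      (Complex.exp (t * Complex.I))) 0 := by
    have hb := fun t : ℝ => norm_tprod_comp_iterate_sub_one_le (F := f lam ν G B)
      (κ := K lam G B S) hf hc0 hc1 hcf hM0 hMK (norm_exp_ofReal_mul_I_le t)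
    have hcts : Continuous fun t : ℝ =>
        Real.exp (M * ‖1 - Complex.exp (t * Complex.I)‖ * (1 - c)⁻¹) - 1 := by fun_prop
    -- At `t = 0` the bound `hb` is `exp 0 - 1 = 0`.
    have h0 : ∏' j, K lam G B S ((f lam ν G B)^[j] (Complex.exp ((0 : ℝ) * Complex.I))) = 1 := by
      have := hb 0
      simp only [Complex.ofReal_zero, zero_mul, Complex.exp_zero, sub_self, norm_zero, mul_zero,
        Real.exp_zero] at this ⊢
      exact sub_eq_zero.1 (norm_eq_zero.1 (le_antisymm this (norm_nonneg _)))
    rw [ContinuousAt]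
    beta_reduce
    rw [h0, tendsto_iff_norm_sub_tendsto_zero]
    exact squeeze_zero (fun _ => norm_nonneg _) hb (by simpa using hcts.tendsto 0)
  obtain ⟨π, hπ, hπφ⟩ := exists_tendsto_of_tendsto_pgf
    (μ := fun n => ⟨P.map (I.X G n), Measure.isProbabilityMeasure_map (hXm n)⟩) hcont
    fun z hz => (hlim z hz).congr fun n => by
      rw [ProbabilityMeasure.coe_mk, integral_map (hXm n) (by fun_prop)]
  refine ⟨π, ⟨hXm, aemeasurable_id, ?_⟩, fun z hz => ?_⟩
  · have hid : ∀ h, (⟨(π : Measure ℕ).map id, h⟩ : ProbabilityMeasure ℕ) = π := fun _ =>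
      Subtype.ext Measure.map_id
    rw [hid]
    exact hπ
  · rw [hπφ z hz]
    exact hprod z hz
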